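/- Let $V$ be a complex vector space of countably infinite dimension, in one of the following situations. Type (A): $V_*\subset V^*$ is a subspace of countably infinite dimension such that the pairing $V_*\times V\to\mathbb C$ is nondegenerate. Type (BD): $\omega$ is a nondegenerate symmetric bilinear form on $V$. Type (C): $\omega$ is a symplectic form on $V$ (a nondegenerate alternating bilinear form). In the last two types put $V_*=\{\omega(v,\cdot):v\in V\}$. Let $\mathbf{GL}(\infty)$ be the group of all $g\in \mathrm{GL}(V)$ such that $g(V_*)=V_*$ and $g$ fixes pointwise a finite-codimensional subspace of $V$ and a finite-codimensional subspace of $V_*$. Let $\mathbf G=\mathbf{GL}(\infty)$ in type (A), and in types (BD) and (C) let $\mathbf G$ (denoted $\mathbf O(\infty)$, respectively $\mathbf{Sp}(\infty)$) be the subgroup of the elements of $\mathbf{GL}(\infty)$ that preserve $\omega$. A basis $E$ of $V$ is called admissible if, in type (A), its dual family spans $V_*$ and, in types (BD) and (C), there is an involution $i_E$ of $E$ with at most one fixed point such that, for $e,e'\in E$, $\omega(e,e')\neq 0$ if and only if $e'=i_E(e)$. For such $E$, let $\mathbf H(E)\subset \mathbf G$ be the subgroup of the elements that are diagonal in $E$,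 and for a finite subset $S\subset E$ let $\mathbf G(S)=\mathbf G\cap \mathrm{GL}(\langle S\rangle)$, where $\mathrm{GL}(\langle S\rangle)$ is the group of all $g\in\mathrm{GL}(V)$ that map $\langle S\rangle$ onto itself and fix every vector of $E\setminus S$. A subgroup $\mathbf P\subset \mathbf G$ is called a splitting parabolic subgroup if there are an admissible basis $E$ and an increasing exhaustion $E=\bigcup_n E_n$ by finite subsets ($i_E$-stable in types (BD) and (C)) such that $\mathbf H(E)\subset \mathbf P$ and, for every $n$, $\mathbf P\cap \mathbf G(E_n)$ is a parabolic subgroup of the classical group $\mathbf G(E_n)$, that is, the stabilizer in $\mathbf G(E_n)$ of a flag (a chain of subspaces) in $\langle E_n\rangle$, which in types (BD) and (C) is stable under $F\mapsto F^\perp\cap\langle E_n\rangle$. A splitting parabolic subgroup $\mathbf P$ is called semilarge if it has only finitely many invariant subspaces in $V$. It is called large if it is semilarge and is the stabilizer in $\mathbf G$ of a finite sequence of subspaces $0=F_0\subsetneq F_1\subsetneq\dots\subsetneq F_m=V$ (with $F_k^\perp=F_{m-k}$ for all $k$ in types (BD) and (C)) in which each $F_k$ is finite dimensional or finite codimensional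 in $V$. Then, for every splitting parabolic subgroup $\mathbf P$ of $\mathbf G$, the group $\mathbf P$, acting by left multiplication, has finitely many orbits on $\mathbf G/\mathbf P$ if and only if $\mathbf P$ is large. -/

import Mathlib

open Module

/-- The three types of data on a complex vector space `V` defining a classical ind-group:
* type (A): a countable-dimensional subspace `Vs` of the dual space which separates the vectors
  of `V`, i.e. the pairing `Vs × V → ℂ` is nondegenerate (nondegeneracy on the side of `Vs` is
  automatic);
* type (BD): a nondegenerate symmetric bilinear form;
* type (C): a symplectic (nondegenerate alternating) bilinear form. -/
inductive ClassicalDatum (V : Type*) [AddCommGroup V] [Module ℂ V]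
  | gl (Vs : Submodule ℂ (Dual ℂ V)) (rank_eq : Module.rank ℂ Vs = Cardinal.aleph0)
      (separating : ∀ v : V, v ≠ 0 → ∃ φ ∈ Vs, φ v ≠ 0)
  | orth (ω : LinearMap.BilinForm ℂ V) (symm : ω.IsSymm) (nondegenerate : ω.Nondegenerate)
  | symp (ω : LinearMap.BilinForm ℂ V) (alt : ω.IsAlt) (nondegenerate : ω.Nondegenerate)

namespace ClassicalDatum

variable {V : Type*} [AddCommGroup V] [Module ℂ V]

/-- The bilinear form `ω` in types (BD) and (C); no form in type (A). -/
def form : ClassicalDatum V → Option (LinearMap.BilinForm ℂ V)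
  | gl _ _ _ => none
  | orth ω _ _ => some ω
  | symp ω _ _ => some ω

/-- The subspace `V_*` of the dual space; in types (BD) and (C) it is `{ω(v, ·) : v ∈ V}`. -/
def Vstar : ClassicalDatum V → Submodule ℂ (Dual ℂ V)
  | gl Vs _ _ => Vs
  | orth ω _ _ => LinearMap.range ω
  | symp ω _ _ => LinearMap.range ω

/-- The group `GL(∞)` attached to `V_* = Vs`: linear automorphisms `g` of `V` with `g(Vs) = Vs`
which fix pointwise a finite-codimensional subspace of `V` and one of `Vs`.
Here `g` acts on linear forms by `φ ↦ φ ∘ g⁻¹ = g.symm.dualMap φ`. -/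
def GLInf (Vs : Submodule ℂ (Dual ℂ V)) : Subgroup (V ≃ₗ[ℂ] V) where
  carrier := {g |
    Vs.map (g.symm.dualMap : Dual ℂ V →ₗ[ℂ] Dual ℂ V) = Vs ∧
    (∃ U : Submodule ℂ V, FiniteDimensional ℂ (V ⧸ U) ∧ ∀ v ∈ U, g v = v) ∧
    (∃ U : Submodule ℂ Vs, FiniteDimensional ℂ (Vs ⧸ U) ∧
      ∀ φ ∈ U, g.symm.dualMap (φ : Dual ℂ V) = φ)}
  one_mem' := by
    refine ⟨?_, ⟨⊤, inferInstance, fun _ _ => rfl⟩, ⟨⊤, inferInstance, fun _ _ => rfl⟩⟩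
    exact Submodule.map_id Vs
  mul_mem' := by
    rintro g h ⟨hg, ⟨U, hU, hgU⟩, ⟨W, hW, hgW⟩⟩ ⟨hh, ⟨U', hU', hhU⟩, ⟨W', hW', hhW⟩⟩
    refine ⟨?_, ⟨U ⊓ U', Submodule.CoFG.inf hU hU', ?_⟩,
      ⟨W ⊓ W', Submodule.CoFG.inf hW hW', ?_⟩⟩
    · conv_rhs => rw [← hg, ← hh, ← Submodule.map_comp]
      rfl
    · rintro v ⟨h1, h2⟩
      change g (h v) = v
      rw [hhU v h2, hgU v h1]
    · rintro φ ⟨h1, h2⟩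
      change g.symm.dualMap (h.symm.dualMap (φ : Dual ℂ V)) = φ
      rw [hhW φ h2, hgW φ h1]
  inv_mem' := by
    rintro g ⟨hg, ⟨U, hU, hgU⟩, ⟨W, hW, hgW⟩⟩
    refine ⟨?_, ⟨U, hU, ?_⟩, ⟨W, hW, ?_⟩⟩
    · have key : (g⁻¹.symm.dualMap : Dual ℂ V →ₗ[ℂ] Dual ℂ V) ∘ₗ
          (g.symm.dualMap : Dual ℂ V →ₗ[ℂ] Dual ℂ V) = LinearMap.id := by
        refine LinearMap.ext fun φ => LinearMap.ext fun v => ?_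
        change φ (g.symm (g v)) = φ v
        simp
      conv_lhs => rw [← hg, ← Submodule.map_comp, key, Submodule.map_id]
    · intro v hv
      change g.symm v = v
      rw [LinearEquiv.symm_apply_eq, hgU v hv]
    · intro φ hφ
      have := hgW φ hφ
      change g.dualMap (φ : Dual ℂ V) = φ
      conv_lhs => rw [← this]
      ext v
      change (φ : Dual ℂ V) (g.symm (g v)) = (φ : Dual ℂ V) v
      simp

/-- The classical ind-group `G`: `GL(∞)` in type (A), and the subgroup of elements of `GL(∞)`
preserving `ω` in types (BD), where it is `O(∞)`, and (C), where it is `Sp(∞)`. -/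
def G (D : ClassicalDatum V) : Subgroup (V ≃ₗ[ℂ] V) where
  carrier := {g | g ∈ GLInf D.Vstar ∧ ∀ ω ∈ D.form, ∀ v w, ω (g v) (g w) = ω v w}
  one_mem' := ⟨one_mem _, fun _ _ _ _ => rfl⟩
  mul_mem' := by
    rintro g h ⟨hg, hg'⟩ ⟨hh, hh'⟩
    refine ⟨mul_mem hg hh, fun ω hω v w => ?_⟩
    change ω (g (h v)) (g (h w)) = ω v w
    rw [hg' ω hω, hh' ω hω]
  inv_mem' := by
    rintro g ⟨hg, hg'⟩
    refine ⟨inv_mem hg, fun ω hω v w => ?_⟩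
    change ω (g.symm v) (g.symm w) = ω v w
    rw [← hg' ω hω, LinearEquiv.apply_symm_apply, LinearEquiv.apply_symm_apply]

/-- `i` is an involution of the (index set of the) basis `E`, with at most one fixed point, such
that `ω(e, e') ≠ 0` if and only if `e' = i(e)`. -/
def IsBasisInvolution (ω : LinearMap.BilinForm ℂ V) (E : Basis ℕ ℂ V) (i : ℕ → ℕ) : Prop :=
  Function.Involutive i ∧ (∀ a b, i a = a → i b = b → a = b) ∧
    ∀ a b, ω (E a) (E b) ≠ 0 ↔ b = i a

/-- Admissible bases. In type (A): the dual family of `E` spans `V_*`.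
In types (BD) and (C): `E` has an involution as in `IsBasisInvolution`.
(All bases of `V` are countably infinite; they are indexed by `ℕ`.) -/
def IsAdmissible (D : ClassicalDatum V) (E : Basis ℕ ℂ V) : Prop :=
  match D.form with
  | none => Submodule.span ℂ (Set.range E.coord) = D.Vstar
  | some ω => ∃ i, IsBasisInvolution ω E i

/-- A filtration `E = ⋃ Eₙ` of the basis by finite subsets, stable under the involution of `E`
in types (BD) and (C). -/
structure IsFiltration (D : ClassicalDatum V) (E : Basis ℕ ℂ V) (S : ℕ → Finset ℕ) : Prop where
  mono : Monotone S
  exhaust : ∀ a, ∃ n, a ∈ S n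
  stable : ∀ ω ∈ D.form, ∀ i, IsBasisInvolution ω E i → ∀ n, ∀ a ∈ S n, i a ∈ S n

/-- The span of the vectors of `E` with index in `S`. -/
def spanOf (E : Basis ℕ ℂ V) (S : Finset ℕ) : Submodule ℂ V :=
  Submodule.span ℂ (E '' (S : Set ℕ))

/-- `g` belongs to `GL(⟨S⟩)`, viewed inside `GL(V)`: it maps the span of `S` onto itself and
fixes all the other vectors of the basis. -/
def InGLSpan (E : Basis ℕ ℂ V) (S : Finset ℕ) (g : V ≃ₗ[ℂ] V) : Prop :=
  (spanOf E S).map (g : V →ₗ[ℂ] V) = spanOf E S ∧ ∀ a ∉ S, g (E a) = E a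

/-- `P ∩ G(S)` is a parabolic subgroup of the finite-dimensional classical group
`G(S) = G ∩ GL(⟨S⟩)` (a general linear, orthogonal or symplectic group on `⟨S⟩`), i.e. it is the
stabilizer in `G(S)` of a flag of subspaces of `⟨S⟩`, where in types (BD) and (C) the flag is
isotropic: it is stable under taking orthogonals in `⟨S⟩`. -/
def IsParabolicAt (D : ClassicalDatum V) (P : Subgroup D.G) (E : Basis ℕ ℂ V) (S : Finset ℕ) :
    Prop :=
  ∃ 𝓕 : Set (Submodule ℂ V),
    IsChain (· ≤ ·) 𝓕 ∧ (∀ F ∈ 𝓕, F ≤ spanOf E S) ∧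
    (∀ ω ∈ D.form, ∀ F ∈ 𝓕, ω.orthogonal F ⊓ spanOf E S ∈ 𝓕) ∧
    ∀ g : D.G, InGLSpan E S g →
      (g ∈ P ↔ ∀ F ∈ 𝓕, F.map ((g : V ≃ₗ[ℂ] V) : V →ₗ[ℂ] V) = F)

/-- Splitting parabolic subgroups of `G`: for some admissible basis `E` and some filtration
`E = ⋃ Eₙ` as above, `P` contains the splitting Cartan subgroup `H(E)` of all elements of `G` which
are diagonal in `E`, and `P ∩ G(Eₙ)` is parabolic in `G(Eₙ)` for all `n`. -/
def IsSplittingParabolic (D : ClassicalDatum V) (P : Subgroup D.G) : Prop :=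
  ∃ E : Basis ℕ ℂ V, D.IsAdmissible E ∧
    (∀ g : D.G, (∀ a, ∃ c : ℂ, (g : V ≃ₗ[ℂ] V) (E a) = c • E a) → g ∈ P) ∧
    ∃ S : ℕ → Finset ℕ, D.IsFiltration E S ∧ ∀ n, D.IsParabolicAt P E (S n)

/-- `P` has only finitely many invariant subspaces in `V`. -/
def IsSemilarge (D : ClassicalDatum V) (P : Subgroup D.G) : Prop :=
  {W : Submodule ℂ V | ∀ g ∈ P, W.map ((g : V ≃ₗ[ℂ] V) : V →ₗ[ℂ] V) = W}.Finite

/-- `P` is semilarge and it is the stabilizer in `G` of a finite sequence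
`0 = F₀ ⊊ F₁ ⊊ ⋯ ⊊ Fₘ = V` (with `Fₖ^⊥ = Fₘ₋ₖ` in types (BD) and (C)) such that each `Fₖ` is
finite dimensional or finite codimensional. -/
def IsLarge (D : ClassicalDatum V) (P : Subgroup D.G) : Prop :=
  D.IsSemilarge P ∧ ∃ (m : ℕ) (F : Fin (m + 1) → Submodule ℂ V),
    StrictMono F ∧ F 0 = ⊥ ∧ F (Fin.last m) = ⊤ ∧
    (∀ ω ∈ D.form, ∀ k, ω.orthogonal (F k) = F k.rev) ∧
    (∀ g : D.G, g ∈ P ↔ ∀ k, (F k).map ((g : V ≃ₗ[ℂ] V) : V →ₗ[ℂ] V) = F k) ∧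
    ∀ k, FiniteDimensional ℂ (F k) ∨ FiniteDimensional ℂ (V ⧸ F k)

end ClassicalDatum

/-! Everything is governed by double cosets: the orbits of `P` on `G/P` are the classes `PgP`.

Preliminaries. In an admissible basis, `G` consists of finitely supported automorphisms preserving
the form, if there is one. It contains lifts of the finitely supported permutations commuting with
the involution, and diagonal elements with distinct eigenvalues on any finite stable set. The latter
force every `P`-invariant subspace to be spanned by basis vectors. A splitting parabolic is the
group of matrices that are block triangular for a total preorder on the basis
(`IsSplittingParabolic.exists_preorder`).

Finite implies large. Functions constant on double cosets take finitely many values. The set of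
`P`-invariant subspaces fixed by `g` is such a function, and together with permutation lifts it
leaves room for only finitely many invariant subspaces (`isSemilarge_of_finite`). Hence the spans of
lower sets of the preorder form a finite chain, whose stabilizer is `P`. For a member `W` of the
chain, the dimension of `(gW + W)/W` is also constant on double cosets. If `W` had infinite
dimension and infinite codimension, permutation lifts would realize every natural number
(`finite_setOf_moved`, `finite_or_finite_compl`).

Large implies finite. The finite-dimensional members of the flag are refined by the spans of initial
segments of a finite sequence `e` in `V`. In type (A) the finite-codimensional members are encoded
by a sequence `φ` in `V_*` which annihilates `e`; with a form they are orthogonals of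
finite-dimensional ones, and `e` also plays the role of `φ`. The stabilizer `H` of these flags lies
in `P`, so it is enough that `H` has finitely many double cosets. To `g` one attaches, for each `k`,
the position of `g e_k` modulo `g⟨e_0, …, e_{k-1}⟩` relative to both flags (`relPos`), and likewise
for `φ` in type (A). These data range over a finite set. If they agree for `g` and `h`, elements of
`H` move the flag of `g` onto that of `h` one vector at a time (`exists_mul_map_flag_eq`). Each step
uses a single transvection in type (A) (`exists_step_of_transvections`), or a single isometry built
from an isotropic vector otherwise (`exists_step_of_form`). -/

namespace ClassicalDatum

variable {V : Type*} [AddCommGroup V] [Module ℂ V]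

/-! ### Admissible bases, finite support of the elements of `G`, and lifts of permutations. -/

section Basis

variable {D : ClassicalDatum V} {E : Basis ℕ ℂ V}

theorem form_apply_eq_coord_smul {ω : LinearMap.BilinForm ℂ V} {i : ℕ → ℕ}
    (hi : IsBasisInvolution ω E i) (a : ℕ) : ω (E a) = ω (E a) (E (i a)) • E.coord (i a) := by
  refine E.ext fun b => ?_
  by_cases hb : b = i a
  · subst hb; simp
  · have : ω (E a) (E b) = 0 := by
      by_contra h
      exact hb ((hi.2.2 a b).1 h)
    simp [this, hb]

theorem range_form_eq_span_coord {ω : LinearMap.BilinForm ℂ V} {i : ℕ → ℕ}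
    (hi : IsBasisInvolution ω E i) :
    LinearMap.range ω = Submodule.span ℂ (Set.range E.coord) := by
  apply le_antisymm
  · rw [LinearMap.range_eq_map, ← E.span_eq, Submodule.map_span, Submodule.span_le]
    rintro _ ⟨_, ⟨a, rfl⟩, rfl⟩
    rw [form_apply_eq_coord_smul hi]
    exact Submodule.smul_mem _ _ (Submodule.subset_span ⟨_, rfl⟩)
  · rw [Submodule.span_le]
    rintro _ ⟨a, rfl⟩
    have h := form_apply_eq_coord_smul hi (i a)
    rw [hi.1 a] at h
    have h0 : ω (E (i a)) (E a) ≠ 0 := (hi.2.2 _ _).2 (hi.1 a).symm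
    refine ⟨(ω (E (i a)) (E a))⁻¹ • E (i a), ?_⟩
    rw [map_smul]
    exact (congrArg ((ω (E (i a)) (E a))⁻¹ • ·) h).trans (inv_smul_smul₀ h0 _)

theorem form_eq_some_cases {ω : LinearMap.BilinForm ℂ V} (hω : ω ∈ D.form) :
    D.Vstar = LinearMap.range ω ∧ ω.Nondegenerate ∧
      ((∀ v w, ω v w = ω w v) ∨ (∀ v, ω v v = 0)) := by
  cases D with
  | gl Vs h1 h2 => simp [form] at hω
  | orth ω' h1 h2 =>
    simp only [form, Option.mem_def, Option.some.injEq] at hω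
    subst hω
    exact ⟨rfl, h2, Or.inl fun v w => by simpa using (h1.eq v w)⟩
  | symp ω' h1 h2 =>
    simp only [form, Option.mem_def, Option.some.injEq] at hω
    subst hω
    exact ⟨rfl, h2, Or.inr h1⟩

theorem IsAdmissible.exists_involution (hE : D.IsAdmissible E) {ω : LinearMap.BilinForm ℂ V}
    (hω : ω ∈ D.form) : ∃ i, IsBasisInvolution ω E i := by
  unfold IsAdmissible at hE
  rw [Option.mem_def.1 hω] at hE
  exact hE

theorem IsAdmissible.vstar_eq (hE : D.IsAdmissible E) :
    D.Vstar = Submodule.span ℂ (Set.range E.coord) := by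
  rcases hf : D.form with _ | ω
  · unfold IsAdmissible at hE
    rw [hf] at hE
    exact hE.symm
  · obtain ⟨i, hi⟩ := hE.exists_involution (ω := ω) hf
    rw [(form_eq_some_cases (D := D) hf).1, range_form_eq_span_coord hi]

theorem mem_span_coord_of_forall_eq_zero (S : Finset ℕ) {φ : Dual ℂ V}
    (h : ∀ a ∉ S, φ (E a) = 0) : φ ∈ Submodule.span ℂ (E.coord '' (S : Set ℕ)) := by
  have : φ = ∑ a ∈ S, φ (E a) • E.coord a := by
    refine E.ext fun b => ?_
    by_cases hb : b ∈ S
    · simp [Finsupp.single_apply, hb]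
    · simp [Finsupp.single_apply, hb, h b hb]
  rw [this]
  exact Submodule.sum_mem _ fun a ha =>
    Submodule.smul_mem _ _ (Submodule.subset_span ⟨a, ha, rfl⟩)

theorem finite_support_of_mem_span_coord {φ : Dual ℂ V}
    (h : φ ∈ Submodule.span ℂ (Set.range E.coord)) : ∃ S : Finset ℕ, ∀ a ∉ S, φ (E a) = 0 := by
  induction h using Submodule.span_induction with
  | mem x hx =>
    obtain ⟨b, rfl⟩ := hx
    refine ⟨{b}, fun a ha => ?_⟩
    simp only [Finset.mem_singleton] at ha
    simp [ha]
  | zero => exact ⟨∅, fun a _ => rfl⟩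
  | add x y _ _ hx hy =>
    obtain ⟨S, hS⟩ := hx
    obtain ⟨T, hT⟩ := hy
    refine ⟨S ∪ T, fun a ha => ?_⟩
    rw [Finset.notMem_union] at ha
    simp [hS a ha.1, hT a ha.2]
  | smul c x _ hx =>
    obtain ⟨S, hS⟩ := hx
    exact ⟨S, fun a ha => by simp [hS a ha]⟩

theorem map_dualMap_symm_le (hE : D.IsAdmissible E) {S : Finset ℕ} {g : V ≃ₗ[ℂ] V}
    (hg : ∀ a ∉ S, g (E a) = E a) :
    D.Vstar.map (g.symm.dualMap : Dual ℂ V →ₗ[ℂ] Dual ℂ V) ≤ D.Vstar := by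
  rintro _ ⟨φ, hφ, rfl⟩
  have h1 : (g.symm.dualMap : Dual ℂ V →ₗ[ℂ] Dual ℂ V) φ - φ ∈ D.Vstar := by
    rw [hE.vstar_eq]
    refine Submodule.span_mono (Set.image_subset_range _ (S : Set ℕ))
      (mem_span_coord_of_forall_eq_zero S fun a ha => ?_)
    change φ (g.symm (E a)) - φ (E a) = 0
    rw [(LinearEquiv.symm_apply_eq g).2 (hg a ha).symm, sub_self]
  simpa using D.Vstar.add_mem h1 hφ

theorem mem_G_of_finite_support (hE : D.IsAdmissible E) (S : Finset ℕ) (g : V ≃ₗ[ℂ] V)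
    (hg : ∀ a ∉ S, g (E a) = E a) (hω : ∀ ω ∈ D.form, ∀ v w, ω (g v) (g w) = ω v w) :
    g ∈ D.G := by
  have hg' : ∀ a ∉ S, g.symm (E a) = E a := fun a ha =>
    (LinearEquiv.symm_apply_eq g).2 (hg a ha).symm
  refine ⟨⟨le_antisymm (map_dualMap_symm_le hE hg) ?_, ?_, ?_⟩, hω⟩
  · intro φ hφ
    refine ⟨g.dualMap φ, map_dualMap_symm_le (g := g.symm) hE hg' ⟨φ, hφ, rfl⟩, ?_⟩
    ext v
    change φ (g (g.symm v)) = φ v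
    simp
  · refine ⟨LinearMap.ker ((g : V →ₗ[ℂ] V) - LinearMap.id), ?_, fun v hv => ?_⟩
    · have : FiniteDimensional ℂ (LinearMap.range ((g : V →ₗ[ℂ] V) - LinearMap.id)) := by
        have hle : LinearMap.range ((g : V →ₗ[ℂ] V) - LinearMap.id) ≤
            Submodule.span ℂ ((fun a => g (E a) - E a) '' (S : Set ℕ)) := by
          rw [LinearMap.range_eq_map, ← E.span_eq, Submodule.map_span, Submodule.span_le]
          rintro _ ⟨_, ⟨a, rfl⟩, rfl⟩
          by_cases ha : a ∈ S
          · exact Submodule.subset_span ⟨a, ha, rfl⟩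
          · simp [hg a ha]
        have := FiniteDimensional.span_of_finite ℂ
          (S.finite_toSet.image (fun a => g (E a) - E a))
        exact Submodule.finiteDimensional_of_le hle
      exact Module.Finite.equiv (LinearMap.quotKerEquivRange _).symm
    · exact sub_eq_zero.1 hv
  · set T : D.Vstar →ₗ[ℂ] Dual ℂ V :=
      ((g.symm.dualMap : Dual ℂ V →ₗ[ℂ] Dual ℂ V) - LinearMap.id) ∘ₗ D.Vstar.subtype
    refine ⟨LinearMap.ker T, ?_, fun v hv => ?_⟩
    · have : FiniteDimensional ℂ (LinearMap.range T) := by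
        have hle : LinearMap.range T ≤ Submodule.span ℂ (E.coord '' (S : Set ℕ)) := by
          rintro _ ⟨φ, rfl⟩
          refine mem_span_coord_of_forall_eq_zero S fun a ha => ?_
          change (φ : Dual ℂ V) (g.symm (E a)) - (φ : Dual ℂ V) (E a) = 0
          rw [hg' a ha, sub_self]
        have := FiniteDimensional.span_of_finite ℂ (S.finite_toSet.image E.coord)
        exact Submodule.finiteDimensional_of_le hle
      exact Module.Finite.equiv (LinearMap.quotKerEquivRange _).symm
    · exact sub_eq_zero.1 hv

theorem finite_support_of_fg {W : Submodule ℂ (Dual ℂ V)} (hW : W.FG)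
    (h : W ≤ Submodule.span ℂ (Set.range E.coord)) :
    ∃ S : Finset ℕ, ∀ φ ∈ W, ∀ a ∉ S, φ (E a) = 0 := by
  obtain ⟨s, rfl⟩ := hW
  choose! T hT using fun φ (hφ : φ ∈ s) =>
    finite_support_of_mem_span_coord (h (Submodule.subset_span hφ))
  refine ⟨s.biUnion T, fun φ hφ a ha => ?_⟩
  induction hφ using Submodule.span_induction with
  | mem x hx => exact hT x hx a fun h => ha (Finset.mem_biUnion.2 ⟨x, hx, h⟩)
  | zero => rfl
  | add x y _ _ hx hy => simp [hx, hy]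
  | smul c x _ hx => simp [hx]

/-- On `V_*` the operator `g - 1` has finite rank, and its image consists of functionals supported
on finitely many basis vectors, hence on a common finite set `S`. Outside `S` no coordinate
distinguishes `g⁻¹ (E a)` from `E a`. -/
theorem exists_finite_support (hE : D.IsAdmissible E) {g : V ≃ₗ[ℂ] V} (hg : g ∈ D.G) :
    ∃ S : Finset ℕ, ∀ a ∉ S, g (E a) = E a := by
  obtain ⟨⟨h1, -, U, hU, hgU⟩, -⟩ := hg
  set T : D.Vstar →ₗ[ℂ] Dual ℂ V :=
      ((g.symm.dualMap : Dual ℂ V →ₗ[ℂ] Dual ℂ V) - LinearMap.id) ∘ₗ D.Vstar.subtype with hT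
  have hker : U ≤ LinearMap.ker T := fun φ hφ => by
    change g.symm.dualMap (φ : Dual ℂ V) - φ = 0
    rw [hgU φ hφ, sub_self]
  have hfin : FiniteDimensional ℂ (LinearMap.range T) := by
    have : FiniteDimensional ℂ (D.Vstar ⧸ LinearMap.ker T) :=
      Module.Finite.of_surjective (Submodule.factor hker) (Submodule.factor_surjective hker)
    exact Module.Finite.equiv (LinearMap.quotKerEquivRange T)
  obtain ⟨S, hS⟩ := finite_support_of_fg (E := E) (Module.Finite.iff_fg.1 hfin) (by
    rw [← hE.vstar_eq]
    rintro _ ⟨φ, rfl⟩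
    refine D.Vstar.sub_mem ?_ φ.2
    exact h1.le ⟨φ, φ.2, rfl⟩)
  refine ⟨S, fun a ha => ?_⟩
  have : g.symm (E a) = E a := by
    refine E.ext_elem fun b => ?_
    have hb : E.coord b ∈ D.Vstar := by
      rw [hE.vstar_eq]; exact Submodule.subset_span ⟨b, rfl⟩
    exact sub_eq_zero.1 (hS _ ⟨⟨E.coord b, hb⟩, rfl⟩ a ha)
  rw [← this, LinearEquiv.apply_symm_apply, this]

theorem mem_spanOf_iff {S : Finset ℕ} {v : V} : v ∈ spanOf E S ↔ ∀ a ∉ S, E.repr v a = 0 := by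
  unfold spanOf
  rw [E.mem_span_image]
  simp only [Set.subset_def, Finset.mem_coe, Finsupp.mem_support_iff, Finset.mem_coe]
  exact forall_congr' fun a => ⟨fun h ha => by_contra fun h' => ha (h h'),
    fun h h' => by_contra fun ha => h' (h ha)⟩

instance (S : Finset ℕ) : FiniteDimensional ℂ (spanOf E S) :=
  FiniteDimensional.span_of_finite ℂ (S.finite_toSet.image E)

theorem map_eq_of_map_le {W : Submodule ℂ V} [FiniteDimensional ℂ W] {g : V ≃ₗ[ℂ] V}
    (h : W.map (g : V →ₗ[ℂ] V) ≤ W) : W.map (g : V →ₗ[ℂ] V) = W :=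
  Submodule.eq_of_le_of_finrank_eq h (LinearEquiv.finrank_map_eq g W)

theorem exists_inGLSpan {g : V ≃ₗ[ℂ] V} {S : Finset ℕ} (hg : ∀ a ∉ S, g (E a) = E a) :
    ∃ T : Finset ℕ, S ⊆ T ∧ ∀ T', T ⊆ T' → InGLSpan E T' g := by
  refine ⟨S ∪ S.biUnion fun a => (E.repr (g (E a))).support, Finset.subset_union_left,
    fun T' hT' => ⟨map_eq_of_map_le ?_, fun a ha => hg a fun h =>
      ha (hT' (Finset.mem_union_left _ h))⟩⟩
  conv_lhs => unfold spanOf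
  rw [Submodule.map_span, Submodule.span_le]
  rintro _ ⟨_, ⟨a, ha, rfl⟩, rfl⟩
  by_cases haS : a ∈ S
  · refine mem_spanOf_iff.2 fun b hb => by_contra fun h => hb (hT' (Finset.mem_union_right _ ?_))
    exact Finset.mem_biUnion.2 ⟨a, haS, Finsupp.mem_support_iff.2 h⟩
  · change g (E a) ∈ spanOf E T'
    rw [hg a haS]
    exact Submodule.subset_span ⟨a, ha, rfl⟩

/-- Elements of `G` which are monomial in the basis `E`. -/
theorem exists_monomial (hE : D.IsAdmissible E) (σ : Equiv.Perm ℕ) (c : ℕ → ℂ)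
    (hc : ∀ a, c a ≠ 0) (S : Finset ℕ) (hσ : ∀ a ∉ S, σ a = a) (hcS : ∀ a ∉ S, c a = 1)
    (hω : ∀ ω ∈ D.form, ∀ a b, c a * c b * ω (E (σ a)) (E (σ b)) = ω (E a) (E b)) :
    ∃ g : D.G, ∀ a, (g : V ≃ₗ[ℂ] V) (E a) = c a • E (σ a) := by
  let E' : Basis ℕ ℂ V := E.unitsSMul fun a => Units.mk0 (c (σ.symm a)) (hc _)
  have hg : ∀ a, E.equiv E' σ (E a) = c a • E (σ a) := fun a => by
    rw [Basis.equiv_apply, Basis.unitsSMul_apply]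
    simp [Units.smul_def]
  refine ⟨⟨E.equiv E' σ, mem_G_of_finite_support hE S _ (fun a ha => ?_) fun ω h => ?_⟩, hg⟩
  · rw [hg, hσ a ha, hcS a ha, one_smul]
  · have : ω.compl₁₂ (E.equiv E' σ : V →ₗ[ℂ] V) (E.equiv E' σ : V →ₗ[ℂ] V) = ω := by
      refine E.ext fun a => E.ext fun b => ?_
      rw [LinearMap.compl₁₂_apply]
      change ω (E.equiv E' σ (E a)) (E.equiv E' σ (E b)) = _
      rw [hg, hg, ← hω ω h a b]
      simp
      ring
    intro v w
    exact LinearMap.congr_fun₂ this v w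

/-- Swapping the arguments of two values costs the same sign twice. This makes the scaling ratio of
a lifted permutation depend only on the pair `{a, i a}`. -/
theorem form_swap_ratio {ω : LinearMap.BilinForm ℂ V} (hω : ω ∈ D.form) (a b c d : ℕ) :
    ω (E a) (E b) * ω (E c) (E d) = ω (E b) (E a) * ω (E d) (E c) := by
  rcases (form_eq_some_cases hω).2.2 with h | h
  · rw [h (E a), h (E c)]
  · have h' : ∀ x y, ω x y = - ω y x := fun x y => by
      have := h (x + y)
      simp only [map_add, LinearMap.add_apply, h, zero_add, add_zero] at this
      linear_combination this
    rw [h' (E a), h' (E c)]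
    ring

/-- A finitely supported permutation commuting with the involution lifts to `G`. -/
theorem exists_lift_perm (hE : D.IsAdmissible E) (σ : Equiv.Perm ℕ) (S : Finset ℕ)
    (hσ : ∀ a ∉ S, σ a = a)
    (hi : ∀ ω ∈ D.form, ∀ i, IsBasisInvolution ω E i → ∀ a, σ (i a) = i (σ a)) :
    ∃ g : D.G, ∀ a, ∃ c : ℂ, c ≠ 0 ∧ (g : V ≃ₗ[ℂ] V) (E a) = c • E (σ a) := by
  rcases hf : D.form with _ | ω
  · obtain ⟨g, hg⟩ := exists_monomial hE σ (fun _ => 1) (fun _ => one_ne_zero) S hσ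
      (fun _ _ => rfl) (fun ω hω => by rw [hf] at hω; simp at hω)
    exact ⟨g, fun a => ⟨1, one_ne_zero, hg a⟩⟩
  · obtain ⟨i, hI⟩ := hE.exists_involution (ω := ω) hf
    have hcomm := hi ω hf i hI
    set r : ℕ → ℂ := fun a => ω (E a) (E (i a)) / ω (E (σ a)) (E (i (σ a))) with hr
    have hne : ∀ a, ω (E a) (E (i a)) ≠ 0 := fun a => (hI.2.2 _ _).2 rfl
    have hri : ∀ a, r (i a) = r a := fun a => by
      have h1 := hne (σ a)
      have h2 : ω (E (i (σ a))) (E (σ a)) ≠ 0 := (hI.2.2 _ _).2 (hI.1 _).symm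
      simp only [hr, hcomm, hI.1 a, hI.1 (σ a)]
      rw [div_eq_div_iff h2 h1]
      exact form_swap_ratio hf _ _ _ _
    have hfix : ∀ a, i a = a → r a = 1 := fun a ha => by
      have : σ a = a := hI.2.1 _ _ (by rw [← hcomm, ha]) ha
      simp only [hr, this, div_self (hne a)]
    have hr0 : ∀ a, r a ≠ 0 := fun a => div_ne_zero (hne _) (hne _)
    -- Only the product `c a * c (i a)` is prescribed, so the whole ratio is put on one member of
    -- each pair. A fixed point of `i` is fixed by `σ` too, and there `r` is `1`, as `c a * c a = r
    -- a` demands.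
    set c : ℕ → ℂ := fun a => if a < i a then 1 else r a with hcdef
    have hcc : ∀ a, c a * c (i a) = r a := fun a => by
      rcases lt_trichotomy a (i a) with h | h | h
      · simp [hcdef, h, hI.1 a, not_lt.2 h.le, hri]
      · simp [hcdef, ← h, hfix a h.symm]
      · simp [hcdef, h, hI.1 a, not_lt.2 h.le]
    obtain ⟨g, hg⟩ := exists_monomial hE σ c
      (fun a => by by_cases h : a < i a <;> simp [hcdef, h, hr0]) (S ∪ S.image i)
      (fun a ha => hσ a fun h => ha (Finset.mem_union_left _ h))
      (fun a ha => by
        rw [Finset.notMem_union] at ha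
        have h1 := hσ a ha.1
        simp [hcdef, hr, h1, hne])
      (fun ω' hω' a b => by
        obtain rfl : ω = ω' := by rw [hf] at hω'; simpa using hω'
        by_cases hb : b = i a
        · subst hb
          rw [hcc, hcomm, hr]
          exact div_mul_cancel₀ _ (hne _)
        · have h1 : ω (E a) (E b) = 0 := by
            by_contra h; exact hb ((hI.2.2 _ _).1 h)
          have h2 : ω (E (σ a)) (E (σ b)) = 0 := by
            by_contra h
            exact hb (σ.injective (((hI.2.2 _ _).1 h).trans (hcomm a).symm))
          rw [h1, h2, mul_zero])
    exact ⟨g, fun a => ⟨c a, by by_cases h : a < i a <;> simp [hcdef, h, hr0], hg a⟩⟩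

end Basis

end ClassicalDatum

namespace ClassicalDatum

variable {V : Type*} [AddCommGroup V] [Module ℂ V]

/-! ### Invariant subspaces are spanned by basis vectors; the preorder describing `P`. -/

section Structure

variable {D : ClassicalDatum V} {E : Basis ℕ ℂ V}

/-- A subspace stable under an operator which is diagonal in `E` contains every basis vector
occurring in one of its elements, provided the eigenvalues involved are distinct. -/
theorem basis_mem_of_diagonal {h : V →ₗ[ℂ] V} {c : ℕ → ℂ} (hc : ∀ a, h (E a) = c a • E a)
    {W : Submodule ℂ V} (hW : ∀ w ∈ W, h w ∈ W) {v : V} (hv : v ∈ W)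
    (hinj : Set.InjOn c (E.repr v).support) {a : ℕ} (ha : E.repr v a ≠ 0) : E a ∈ W := by
  classical
  -- Up to a nonzero scalar this is the Lagrange polynomial at `c a`: `p(h)` kills every term of `v`
  -- except the one along `E a`.
  set p : Polynomial ℂ :=
    ∏ b ∈ (E.repr v).support.erase a, (Polynomial.X - Polynomial.C (c b)) with hp
  have hbasis : ∀ q : Polynomial ℂ, ∀ b, Polynomial.aeval h q (E b) = q.eval (c b) • E b := by
    intro q b
    refine Module.End.aeval_apply_of_hasEigenvector ⟨?_, E.ne_zero b⟩
    exact Module.End.mem_eigenspace_iff.2 (hc b)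
  have hstab : ∀ q : Polynomial ℂ, ∀ w ∈ W, Polynomial.aeval h q w ∈ W := by
    intro q
    induction q using Polynomial.induction_on' with
    | add p q hp hq => intro w hw; simpa using W.add_mem (hp w hw) (hq w hw)
    | monomial n r =>
      intro w hw
      rw [Polynomial.aeval_monomial]
      refine W.smul_mem r ?_
      induction n with
      | zero => simpa using hw
      | succ n ih => rw [pow_succ']; exact hW _ ih
  have h1 : Polynomial.aeval h p v = (E.repr v a * p.eval (c a)) • E a := by
    conv_lhs => rw [← E.linearCombination_repr v, Finsupp.linearCombination_apply, Finsupp.sum]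
    rw [map_sum, Finset.sum_eq_single a]
    · rw [map_smul, hbasis, smul_smul]
    · intro b hb hba
      rw [map_smul, hbasis, hp, Polynomial.eval_prod,
        Finset.prod_eq_zero (Finset.mem_erase.2 ⟨hba, hb⟩) (by simp), zero_smul, smul_zero]
    · intro h; exact absurd (Finsupp.mem_support_iff.2 ha) h
  have h2 : E.repr v a * p.eval (c a) ≠ 0 := by
    refine mul_ne_zero ha ?_
    rw [hp, Polynomial.eval_prod, Finset.prod_ne_zero_iff]
    intro b hb
    obtain ⟨hba, hb⟩ := Finset.mem_erase.1 hb
    simp only [Polynomial.eval_sub, Polynomial.eval_X, Polynomial.eval_C]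
    exact sub_ne_zero.2 fun h => hba (hinj hb (Finsupp.mem_support_iff.2 ha) h.symm)
  have h3 := hstab p v hv
  rw [h1] at h3
  exact (Submodule.smul_mem_iff _ h2).1 h3

/-- Stability of an index set under the involution in types (BD) and (C). -/
def IsStableIndex (D : ClassicalDatum V) (E : Basis ℕ ℂ V) (S : Finset ℕ) : Prop :=
  ∀ ω ∈ D.form, ∀ i, IsBasisInvolution ω E i → ∀ a ∈ S, i a ∈ S

theorem IsBasisInvolution.unique {ω : LinearMap.BilinForm ℂ V} {i j : ℕ → ℕ}
    (hi : IsBasisInvolution ω E i) (hj : IsBasisInvolution ω E j) : i = j :=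
  funext fun a => (hj.2.2 a (i a)).1 ((hi.2.2 a (i a)).2 rfl)

theorem exists_isStableIndex (hE : D.IsAdmissible E) (S : Finset ℕ) :
    ∃ T, S ⊆ T ∧ IsStableIndex D E T := by
  rcases hf : D.form with _ | ω
  · exact ⟨S, subset_rfl, fun ω hω => by rw [hf] at hω; simp at hω⟩
  · obtain ⟨i, hI⟩ := hE.exists_involution (ω := ω) hf
    refine ⟨S ∪ S.image i, Finset.subset_union_left, fun ω' hω' j hj a ha => ?_⟩
    obtain rfl : ω = ω' := by rw [hf] at hω'; simpa using hω'
    obtain rfl := hI.unique hj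
    rcases Finset.mem_union.1 ha with h | h
    · exact Finset.mem_union_right _ (Finset.mem_image_of_mem _ h)
    · obtain ⟨b, hb, rfl⟩ := Finset.mem_image.1 h
      rw [hI.1]
      exact Finset.mem_union_left _ hb

theorem exists_regular_diagonal (hE : D.IsAdmissible E) {S : Finset ℕ}
    (hS : IsStableIndex D E S) :
    ∃ (h : D.G) (c : ℕ → ℂ), (∀ a, (h : V ≃ₗ[ℂ] V) (E a) = c a • E a) ∧ (∀ a ∉ S, c a = 1) ∧
      Set.InjOn c S := by
  have nat_ne : ∀ a b : ℕ, ((a : ℂ) + 2) * (b + 2) ≠ 1 := fun a b h => by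
    have : (a + 2) * (b + 2) = 1 := by exact_mod_cast h
    nlinarith
  have nat_ne' : ∀ a : ℕ, (a : ℂ) + 2 ≠ 1 := fun a h => by
    have : a + 2 = 1 := by exact_mod_cast h
    omega
  have nat_ne0 : ∀ a : ℕ, (a : ℂ) + 2 ≠ 0 := fun a h => by
    have : a + 2 = 0 := by exact_mod_cast h
    omega
  rcases hf : D.form with _ | ω
  · obtain ⟨h, hh⟩ := exists_monomial hE 1 (fun a => if a ∈ S then (a : ℂ) + 2 else 1)
      (fun a => by by_cases ha : a ∈ S <;> simp [ha, nat_ne0]) S (fun _ _ => rfl)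
      (fun a ha => by simp [ha]) (fun ω hω => by rw [hf] at hω; simp at hω)
    refine ⟨h, _, hh, fun a ha => by simp [ha], fun a ha b hb hab => ?_⟩
    have ha' : a ∈ S := ha
    have hb' : b ∈ S := hb
    simpa [ha', hb'] using hab
  · obtain ⟨i, hI⟩ := hE.exists_involution (ω := ω) hf
    have hiS : ∀ a, i a ∈ S ↔ a ∈ S := fun a =>
      ⟨fun h => by simpa [hI.1 a] using hS ω hf i hI _ h, hS ω hf i hI a⟩
    -- The isometry condition is `c a * c (i a) = 1`. The values `a + 2` exceed `1` and their
    -- inverses are below `1`, so they never collide with each other or with the value `1` at the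
    -- fixed point.
    set c : ℕ → ℂ := fun a =>
      if a ∈ S then (if a < i a then (a : ℂ) + 2 else if i a < a then ((i a : ℂ) + 2)⁻¹ else 1)
        else 1 with hc
    have hc0 : ∀ a, c a ≠ 0 := fun a => by
      simp only [hc]; split_ifs <;> simp [nat_ne0]
    obtain ⟨h, hh⟩ := exists_monomial hE 1 c hc0 S (fun _ _ => rfl)
      (fun a ha => by simp [hc, ha]) (fun ω' hω' a b => by
        obtain rfl : ω = ω' := by rw [hf] at hω'; simpa using hω'
        by_cases hb : b = i a
        · subst hb
          suffices c a * c (i a) = 1 by simp [this]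
          by_cases ha : a ∈ S
          · rcases lt_trichotomy a (i a) with h | h | h
            · simp [hc, ha, hiS, h, hI.1 a, not_lt.2 h.le, nat_ne0]
            · simp [hc, ← h]
            · simp [hc, ha, hiS, h, hI.1 a, not_lt.2 h.le, nat_ne0]
          · simp [hc, ha, hiS]
        · have h1 : ω (E a) (E b) = 0 := by
            by_contra h; exact hb ((hI.2.2 _ _).1 h)
          simp [h1])
    refine ⟨h, c, hh, fun a ha => by simp [hc, ha], fun a ha b hb hab => ?_⟩
    have ha' : a ∈ S := ha
    have hb' : b ∈ S := hb
    simp only [hc, ha', hb', if_true] at hab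
    rcases lt_trichotomy a (i a) with h1 | h1 | h1 <;>
      rcases lt_trichotomy b (i b) with h2 | h2 | h2
    · simpa [h1, h2] using hab
    · simp [h1, ← h2, nat_ne'] at hab
    · simp only [h1, h2, not_lt.2 h2.le, if_true, if_false] at hab
      exact absurd (by rw [hab, inv_mul_cancel₀ (nat_ne0 _)]) (nat_ne a (i b))
    · simp [← h1, h2, (nat_ne' _).symm] at hab
    · exact hI.2.1 _ _ h1.symm h2.symm
    · simp only [← h1, h2, not_lt.2 h2.le, if_true, if_false, lt_irrefl] at hab
      exact absurd (inv_eq_one.1 hab.symm) (nat_ne' _)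
    · simp only [h1, h2, not_lt.2 h1.le, if_true, if_false] at hab
      exact absurd (by rw [← hab, inv_mul_cancel₀ (nat_ne0 _)]) (nat_ne b (i a))
    · simp only [h1, ← h2, not_lt.2 h1.le, if_true, if_false, lt_irrefl] at hab
      exact absurd (inv_eq_one.1 hab) (nat_ne' _)
    · simp only [h1, h2, not_lt.2 h1.le, not_lt.2 h2.le, if_true, if_false, inv_inj,
        add_left_inj, Nat.cast_inj] at hab
      rw [← hI.1 a, hab, hI.1]

/-- The regular diagonal element supported on `S` belongs to `P`. Only invariance under `P ∩ G(S)`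
is required, so the members of the flags at finite level are covered. -/
theorem basis_mem_of_mem_spanOf_of_stable (hE : D.IsAdmissible E) {P : Subgroup D.G}
    (hP : ∀ g : D.G, (∀ a, ∃ c : ℂ, (g : V ≃ₗ[ℂ] V) (E a) = c • E a) → g ∈ P)
    {S : Finset ℕ} (hS : IsStableIndex D E S) {W : Submodule ℂ V}
    (hW : ∀ g ∈ P, InGLSpan E S g → W.map ((g : V ≃ₗ[ℂ] V) : V →ₗ[ℂ] V) = W) {v : V} (hv : v ∈ W)
    (hvS : v ∈ spanOf E S) {a : ℕ} (ha : E.repr v a ≠ 0) : E a ∈ W := by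
  obtain ⟨h, c, hc, hc1, hinj⟩ := exists_regular_diagonal hE hS
  have hmem : h ∈ P := hP h fun a => ⟨c a, hc a⟩
  have hgl : InGLSpan E S h := by
    refine ⟨map_eq_of_map_le ?_, fun a ha => by rw [hc, hc1 a ha, one_smul]⟩
    conv_lhs => unfold spanOf
    rw [Submodule.map_span, Submodule.span_le]
    rintro _ ⟨_, ⟨a, ha, rfl⟩, rfl⟩
    change (h : V ≃ₗ[ℂ] V) (E a) ∈ spanOf E S
    rw [hc]
    exact Submodule.smul_mem _ _ (Submodule.subset_span ⟨a, ha, rfl⟩)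
  refine basis_mem_of_diagonal (h := ((h : V ≃ₗ[ℂ] V) : V →ₗ[ℂ] V)) hc
    (fun w hw => ?_) hv (hinj.mono ?_) ha
  · rw [← hW h hmem hgl]
    exact ⟨w, hw, rfl⟩
  · intro b hb
    by_contra hbS
    exact (Finsupp.mem_support_iff.1 hb) (mem_spanOf_iff.1 hvS b hbS)

theorem basis_mem_of_invariant (hE : D.IsAdmissible E) {P : Subgroup D.G}
    (hP : ∀ g : D.G, (∀ a, ∃ c : ℂ, (g : V ≃ₗ[ℂ] V) (E a) = c • E a) → g ∈ P)
    {W : Submodule ℂ V}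
    (hW : ∀ g ∈ P, W.map ((g : V ≃ₗ[ℂ] V) : V →ₗ[ℂ] V) = W) {v : V} (hv : v ∈ W)
    {a : ℕ} (ha : E.repr v a ≠ 0) : E a ∈ W := by
  obtain ⟨S, hvS, hS⟩ := exists_isStableIndex hE (E.repr v).support
  refine basis_mem_of_mem_spanOf_of_stable hE hP hS (fun g hg _ => hW g hg) hv
    (mem_spanOf_iff.2 fun b hb => ?_) ha
  by_contra h
  exact hb (hvS (Finsupp.mem_support_iff.2 h))

theorem le_of_basis_mem {W W' : Submodule ℂ V}
    (hW : ∀ v ∈ W, ∀ a, E.repr v a ≠ 0 → E a ∈ W) (h : ∀ a, E a ∈ W → E a ∈ W') : W ≤ W' := by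
  intro v hv
  rw [← E.linearCombination_repr v, Finsupp.linearCombination_apply, Finsupp.sum]
  exact Submodule.sum_mem _ fun a ha =>
    Submodule.smul_mem _ _ (h a (hW v hv a (Finsupp.mem_support_iff.1 ha)))

/-- A splitting parabolic subgroup is described by a total preorder on the basis. -/
theorem IsSplittingParabolic.exists_preorder {P : Subgroup D.G} (hP : D.IsSplittingParabolic P) :
    ∃ E : Basis ℕ ℂ V, D.IsAdmissible E ∧
      (∀ g : D.G, (∀ a, ∃ c : ℂ, (g : V ≃ₗ[ℂ] V) (E a) = c • E a) → g ∈ P) ∧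
      ∃ r : ℕ → ℕ → Prop, (∀ a, r a a) ∧ (∀ a b c, r a b → r b c → r a c) ∧
        (∀ a b, r a b ∨ r b a) ∧
        (∀ ω ∈ D.form, ∀ i, IsBasisInvolution ω E i → ∀ a b, r a b → r (i b) (i a)) ∧
        ∀ g : D.G, g ∈ P ↔ ∀ a b, E.repr ((g : V ≃ₗ[ℂ] V) (E b)) a ≠ 0 → r a b := by
  obtain ⟨E, hE, hH, S, hS, hpar⟩ := hP
  refine ⟨E, hE, hH, ?_⟩
  choose 𝓕 hchain hle hperp hstab using hpar
  have hex : ∀ T : Finset ℕ, ∃ n, ∀ m ≥ n, T ⊆ S m := by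
    intro T
    choose f hf using hS.exhaust
    refine ⟨T.sup f, fun m hm a ha => hS.mono ((Finset.le_sup ha).trans hm) (hf a)⟩
  have hmemF : ∀ n, ∀ F ∈ 𝓕 n, ∀ v ∈ F, ∀ a, E.repr v a ≠ 0 → E a ∈ F := fun n F hF v hv a ha =>
    basis_mem_of_mem_spanOf_of_stable hE hH (fun ω hω i hi => hS.stable ω hω i hi n)
      (fun g hg hg' => (hstab n g hg').1 hg F hF) hv (hle n F hF hv) ha
  -- The flag at level `n` preorders the basis by the order in which vectors enter it; `P ∩ G(Eₙ)`
  -- is the group of matrices triangular for this preorder.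
  let rn : ℕ → ℕ → ℕ → Prop := fun n a b => ∀ F ∈ 𝓕 n, E b ∈ F → E a ∈ F
  have rn_total : ∀ n a b, rn n a b ∨ rn n b a := by
    intro n a b
    by_contra! h
    obtain ⟨h1, h2⟩ := h
    simp only [rn, not_forall] at h1 h2
    obtain ⟨F, hF, hbF, haF⟩ := h1
    obtain ⟨F', hF', haF', hbF'⟩ := h2
    rcases (hchain n).total hF hF' with h | h
    · exact hbF' (h hbF)
    · exact haF (h haF')
  have rn_iff : ∀ n, ∀ g : D.G, InGLSpan E (S n) g →
      (g ∈ P ↔ ∀ a b, E.repr ((g : V ≃ₗ[ℂ] V) (E b)) a ≠ 0 → rn n a b) := by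
    intro n g hg
    rw [hstab n g hg]
    constructor
    · intro h a b hab F hF hb
      refine hmemF n F hF _ ?_ a hab
      rw [← h F hF]
      exact ⟨_, hb, rfl⟩
    · intro h F hF
      have : FiniteDimensional ℂ F := Submodule.finiteDimensional_of_le (hle n F hF)
      refine map_eq_of_map_le (Submodule.map_le_iff_le_comap.2
        (le_of_basis_mem (hmemF n F hF) fun b hb => ?_))
      change (g : V ≃ₗ[ℂ] V) (E b) ∈ F
      rw [← E.linearCombination_repr ((g : V ≃ₗ[ℂ] V) (E b)),
        Finsupp.linearCombination_apply, Finsupp.sum]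
      exact Submodule.sum_mem _ fun a ha =>
        Submodule.smul_mem _ _ (h a b (Finsupp.mem_support_iff.1 ha) F hF hb)
  have rn_inv : ∀ n, ∀ ω ∈ D.form, ∀ i, IsBasisInvolution ω E i → ∀ a ∈ S n, ∀ b ∈ S n,
      rn n a b → rn n (i b) (i a) := by
    intro n ω hω i hi a ha b hb hab F hF hia
    by_contra hib
    -- Since `F` is spanned by basis vectors, its orthogonal contains `E c` exactly when the partner
    -- of `E c` is missing from `F`. Stability of the flag under orthogonals thus makes the
    -- involution order-reversing.
    have key : ∀ c ∈ S n, E c ∈ ω.orthogonal F ⊓ spanOf E (S n) ↔ E (i c) ∉ F := by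
      intro c hc
      have hc' : E c ∈ spanOf E (S n) := Submodule.subset_span ⟨c, hc, rfl⟩
      constructor
      · rintro ⟨h1, -⟩ h2
        exact (hi.2.2 _ _).2 (hi.1 c).symm (h1 _ h2)
      · intro h
        refine ⟨fun v hv => ?_, hc'⟩
        change ω v (E c) = 0
        rw [← E.linearCombination_repr v, Finsupp.linearCombination_apply, Finsupp.sum, map_sum,
          LinearMap.sum_apply]
        refine Finset.sum_eq_zero fun d hd => ?_
        rw [map_smul, LinearMap.smul_apply]
        have : ω (E d) (E c) = 0 := by
          by_contra hne
          have hcd := (hi.2.2 _ _).1 hne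
          rw [hcd, hi.1] at h
          exact h (hmemF n F hF v hv d (Finsupp.mem_support_iff.1 hd))
        rw [this, smul_zero]
    have h1 := (key b hb).2 hib
    have h2 := hab _ (hperp n ω hω F hF) h1
    exact (key a ha).1 h2 hia
  -- The preorders at different levels are not known to be compatible, so a limit is taken along a
  -- nonprincipal ultrafilter. Totality survives because an ultrafilter decides every disjunction.
  let U := Filter.hyperfilter ℕ
  have hU : ∀ n, ∀ᶠ m in (U : Filter ℕ), n ≤ m := fun n =>
    Nat.hyperfilter_le_atTop (Filter.eventually_ge_atTop n)
  refine ⟨fun a b => ∀ᶠ n in (U : Filter ℕ), rn n a b, fun a => Filter.Eventually.of_forall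
    fun n F _ h => h, fun a b c hab hbc => ?_, fun a b => ?_, fun ω hω i hi a b hab => ?_,
    fun g => ?_⟩
  · filter_upwards [hab, hbc] with n h1 h2 F hF hc using h1 F hF (h2 F hF hc)
  · rw [← Ultrafilter.eventually_or]
    exact Filter.Eventually.of_forall fun n => rn_total n a b
  · obtain ⟨n, hn⟩ := hex {a, b}
    filter_upwards [hab, hU n] with m h1 h2
    have := hn m h2
    exact rn_inv m ω hω i hi a (this (by simp)) b (this (by simp)) h1
  · obtain ⟨T, hT⟩ := exists_finite_support hE g.2
    obtain ⟨T', hTT', hT'⟩ := exists_inGLSpan hT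
    obtain ⟨n, hn⟩ := hex T'
    have hgl : ∀ m ≥ n, InGLSpan E (S m) g := fun m hm => hT' _ (hn m hm)
    constructor
    · intro hg a b hab
      filter_upwards [hU n] with m hm using (rn_iff m g (hgl m hm)).1 hg a b hab
    · intro h
      -- An element of `G` involves only finitely many pairs of indices, so all the limit relations
      -- it uses hold simultaneously at some large level.
      have : ∀ᶠ m in (U : Filter ℕ), ∀ x ∈ T' ×ˢ T',
          E.repr ((g : V ≃ₗ[ℂ] V) (E x.2)) x.1 ≠ 0 → rn m x.1 x.2 := by
        rw [Filter.eventually_all_finset]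
        intro x _
        by_cases hx : E.repr ((g : V ≃ₗ[ℂ] V) (E x.2)) x.1 ≠ 0
        · filter_upwards [h _ _ hx] with m hm _ using hm
        · exact Filter.Eventually.of_forall fun m h => absurd h hx
      obtain ⟨m, hm1, hm2⟩ := (this.and (hU n)).exists
      refine (rn_iff m g (hgl m hm2)).2 fun a b hab => ?_
      by_cases hb : b ∈ T'
      · have ha : a ∈ T' := by
          by_contra ha
          refine hab ((mem_spanOf_iff (S := T')).1 ?_ a ha)
          rw [← (hT' T' subset_rfl).1]
          exact ⟨E b, Submodule.subset_span ⟨b, hb, rfl⟩, rfl⟩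
        exact hm1 (a, b) (Finset.mk_mem_product ha hb) hab
      · rw [hT b fun h => hb (hTT' h)] at hab
        obtain rfl : b = a := by
          by_contra hne
          simp [hne] at hab
        exact fun F _ h => h

end Structure

end ClassicalDatum

namespace ClassicalDatum

/-! ### Orbits on `G/P` as double cosets, and finite chains. -/

section DoubleCosets

variable {G : Type*} [Group G] {P : Subgroup G}

theorem orbit_mk_eq_iff {g h : G} :
    (Quotient.mk'' (g : G ⧸ P) : MulAction.orbitRel.Quotient P (G ⧸ P)) =
      Quotient.mk'' (h : G ⧸ P) ↔ ∃ p ∈ P, ∃ q ∈ P, h = p * g * q := by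
  rw [eq_comm, Quotient.eq'', MulAction.orbitRel_apply, MulAction.mem_orbit_iff]
  constructor
  · rintro ⟨p, hp⟩
    have : ((p.1 * g : G) : G ⧸ P) = h := hp
    rw [QuotientGroup.eq] at this
    exact ⟨p, p.2, _, this, by group⟩
  · rintro ⟨p, hp, q, hq, rfl⟩
    refine ⟨⟨p, hp⟩, ?_⟩
    change ((p * g : G) : G ⧸ P) = _
    rw [QuotientGroup.eq]
    simpa [mul_assoc] using hq

theorem finite_range_of_biinvariant [Finite (MulAction.orbitRel.Quotient P (G ⧸ P))] {α : Type*}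
    (f : G → α) (hf : ∀ p ∈ P, ∀ q ∈ P, ∀ g, f (p * g * q) = f g) : (Set.range f).Finite := by
  let π : G → MulAction.orbitRel.Quotient P (G ⧸ P) := fun g => Quotient.mk'' (g : G ⧸ P)
  have hsurj : Function.Surjective π := by
    intro x
    induction x using Quotient.inductionOn' with
    | h y =>
      induction y using QuotientGroup.induction_on with
      | H g => exact ⟨g, rfl⟩
  refine (Set.finite_range (f ∘ Function.surjInv hsurj)).subset ?_
  rintro _ ⟨g, rfl⟩
  refine ⟨π g, ?_⟩
  obtain ⟨p, hp, q, hq, h⟩ := orbit_mk_eq_iff.1 (Function.surjInv_eq hsurj (π g))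
  change f (Function.surjInv hsurj (π g)) = f g
  conv_rhs => rw [h, hf p hp q hq]

theorem finite_of_separating {α : Type*} [Finite α] (f : G → α)
    (hf : ∀ g h, f g = f h → ∃ p ∈ P, ∃ q ∈ P, h = p * g * q) :
    Finite (MulAction.orbitRel.Quotient P (G ⧸ P)) := by
  have hr : Finite (Set.range f) := inferInstance
  refine Finite.of_surjective
    (fun y : Set.range f => (Quotient.mk'' ((y.2.choose : G) : G ⧸ P) :
      MulAction.orbitRel.Quotient P (G ⧸ P))) fun x => ?_
  induction x using Quotient.inductionOn' with
  | h y =>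
    induction y using QuotientGroup.induction_on with
    | H g =>
      refine ⟨⟨f g, g, rfl⟩, orbit_mk_eq_iff.2 (hf _ _ ?_)⟩
      exact Exists.choose_spec (p := fun y => f y = f g) ⟨g, rfl⟩

end DoubleCosets

theorem exists_strictMono_range_eq {α : Type*} [PartialOrder α] {s : Set α} (hs : s.Finite)
    (hne : s.Nonempty) (hc : ∀ x ∈ s, ∀ y ∈ s, x ≤ y ∨ y ≤ x) :
    ∃ (m : ℕ) (F : Fin (m + 1) → α), StrictMono F ∧ Set.range F = s := by
  classical
  have : Fintype s := hs.fintype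
  let _ : LinearOrder s :=
    { (inferInstance : PartialOrder s) with
      le_total := fun x y => hc x x.2 y y.2
      toDecidableLE := Classical.decRel _ }
  have hcard : Fintype.card s ≠ 0 := by
    have : Nonempty s := hne.to_subtype
    exact Fintype.card_ne_zero
  obtain ⟨m, hm⟩ := Nat.exists_eq_succ_of_ne_zero hcard
  refine ⟨m, fun k => (monoEquivOfFin s hm k : α), fun a b h => ?_, ?_⟩
  · exact (monoEquivOfFin s hm).strictMono h
  · ext x
    constructor
    · rintro ⟨k, rfl⟩
      exact (monoEquivOfFin s hm k).2
    · intro hx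
      exact ⟨(monoEquivOfFin s hm).symm ⟨x, hx⟩, by simp⟩

variable {V : Type*} [AddCommGroup V] [Module ℂ V]

/-! ### Finitely many double cosets imply that `P` is large. -/

section Necessity

variable {D : ClassicalDatum V} {E : Basis ℕ ℂ V} {P : Subgroup D.G}

theorem map_mul_eq (g h : D.G) (W : Submodule ℂ V) :
    W.map (((g * h : D.G) : V ≃ₗ[ℂ] V) : V →ₗ[ℂ] V) =
      (W.map ((h : V ≃ₗ[ℂ] V) : V →ₗ[ℂ] V)).map ((g : V ≃ₗ[ℂ] V) : V →ₗ[ℂ] V) := by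
  rw [← Submodule.map_comp]
  rfl

theorem map_injective (g : D.G) :
    Function.Injective (Submodule.map ((g : V ≃ₗ[ℂ] V) : V →ₗ[ℂ] V)) :=
  Submodule.map_injective_of_injective (g : V ≃ₗ[ℂ] V).injective

theorem map_eq_of_forall_map_le {W : Submodule ℂ V}
    (h : ∀ g ∈ P, W.map ((g : V ≃ₗ[ℂ] V) : V →ₗ[ℂ] V) ≤ W) {g : D.G} (hg : g ∈ P) :
    W.map ((g : V ≃ₗ[ℂ] V) : V →ₗ[ℂ] V) = W := by
  refine le_antisymm (h g hg) ?_
  have := Submodule.map_mono (f := ((g : V ≃ₗ[ℂ] V) : V →ₗ[ℂ] V)) (h g⁻¹ (P.inv_mem hg))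
  rw [← map_mul_eq, mul_inv_cancel] at this
  exact le_of_eq_of_le (Submodule.map_id W).symm this

theorem map_eq_of_perm {g : V ≃ₗ[ℂ] V} {σ : Equiv.Perm ℕ}
    (hg : ∀ a, ∃ c : ℂ, c ≠ 0 ∧ g (E a) = c • E (σ a)) {W : Submodule ℂ V}
    (hW : ∀ v ∈ W, ∀ a, E.repr v a ≠ 0 → E a ∈ W) (h : ∀ a, E a ∈ W ↔ E (σ a) ∈ W) :
    W.map (g : V →ₗ[ℂ] V) = W := by
  apply le_antisymm
  · refine Submodule.map_le_iff_le_comap.2 (le_of_basis_mem hW fun a ha => ?_)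
    obtain ⟨c, -, hc⟩ := hg a
    change g (E a) ∈ W
    rw [hc]
    exact W.smul_mem _ ((h a).1 ha)
  · refine le_of_basis_mem hW fun a ha => ?_
    obtain ⟨c, hc0, hc⟩ := hg (σ.symm a)
    refine ⟨c⁻¹ • E (σ.symm a), W.smul_mem _ ((h _).2 (by simpa using ha)), ?_⟩
    change g _ = _
    rw [map_smul, hc, smul_smul, inv_mul_cancel₀ hc0, one_smul, Equiv.apply_symm_apply]

/-- The involution of the basis in types (BD) and (C), and the identity in type (A). -/
theorem IsAdmissible.exists_involutive (hE : D.IsAdmissible E) :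
    ∃ j : ℕ → ℕ, Function.Involutive j ∧
      (D.form ≠ none → ∀ a b, j a = a → j b = b → a = b) ∧
      ∀ ω ∈ D.form, ∀ i, IsBasisInvolution ω E i → i = j := by
  rcases hf : D.form with _ | ω
  · exact ⟨id, fun _ => rfl, by simp, by simp⟩
  · obtain ⟨i, hI⟩ := hE.exists_involution (ω := ω) hf
    refine ⟨i, hI.1, fun _ => hI.2.1, fun ω' hω' j hj => ?_⟩
    obtain rfl : ω = ω' := by simpa using hω'
    exact hj.unique hI

theorem exists_swap_mem (hE : D.IsAdmissible E) {j : ℕ → ℕ} (hj : Function.Involutive j)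
    (hfix : D.form ≠ none → ∀ a b, j a = a → j b = b → a = b)
    (hjE : ∀ ω ∈ D.form, ∀ i, IsBasisInvolution ω E i → i = j) {W : Submodule ℂ V}
    (hW : ∀ v ∈ W, ∀ a, E.repr v a ≠ 0 → E a ∈ W) {y y' : ℕ} (h1 : E y ∈ W ↔ E y' ∈ W)
    (h2 : E (j y) ∈ W ↔ E (j y') ∈ W) (h3 : j y = y ↔ j y' = y') :
    ∃ g : D.G, W.map ((g : V ≃ₗ[ℂ] V) : V →ₗ[ℂ] V) = W ∧
      ∃ c : ℂ, c ≠ 0 ∧ (g : V ≃ₗ[ℂ] V) (E y) = c • E y' := by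
  by_cases hyy : y = y'
  · subst hyy
    exact ⟨1, Submodule.map_id W, 1, one_ne_zero, (one_smul _ _).symm⟩
  -- The transposition of `y` and `y'`, completed by that of their partners. With a form, neither
  -- index is a fixed point of `j`, because by `h3` both would be; so `f` commutes with `j`.
  set f : ℕ → ℕ := fun a => if a = y then y' else if a = y' then y else
    if a = j y then j y' else if a = j y' then j y else a with hf
  have hjj : ∀ a, j (j a) = a := hj
  have hjinj : ∀ a b, j a = j b → a = b := fun a b h => hj.injective h
  have hinv : Function.Involutive f := by
    intro a
    simp only [hf]
    grind
  let σ : Equiv.Perm ℕ := hinv.toPerm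
  obtain ⟨g, hg⟩ := exists_lift_perm hE σ {y, y', j y, j y'}
    (fun a ha => by
      simp only [Finset.mem_insert, Finset.mem_singleton, not_or] at ha
      change f a = a
      simp [hf, ha])
    (fun ω hω i hi a => by
      obtain rfl := hjE ω hω i hi
      have hfix' := hfix (by rw [Option.mem_def.1 hω]; simp)
      have h4 : i y ≠ y := fun h => hyy (hfix' _ _ h (h3.1 h))
      have h5 : i y' ≠ y' := fun h => h4 (h3.2 h)
      change f (i a) = i (f a)
      simp only [hf]
      grind)
  refine ⟨g, map_eq_of_perm hg hW fun a => ?_, ?_⟩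
  · change _ ↔ E (f a) ∈ W
    simp only [hf]
    split_ifs with ha hb hc hd
    · rw [ha, h1]
    · rw [hb, h1]
    · rw [hc, h2]
    · rw [hd, h2]
    · rfl
  · obtain ⟨c, hc0, hc⟩ := hg y
    refine ⟨c, hc0, hc.trans ?_⟩
    change c • E (f y) = _
    simp [hf]

/-- Whether `g` fixes an invariant `W` depends only on `PgP`, so the invariant subspaces fall into
finitely many classes according to which `g` fix them. Within the class of `W₀`, a subspace is fixed
by all permutation lifts fixing `W₀`, and this leaves finitely many choices. -/
theorem isSemilarge_of_finite [Finite (MulAction.orbitRel.Quotient P (D.G ⧸ P))]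
    (hE : D.IsAdmissible E)
    (hH : ∀ g : D.G, (∀ a, ∃ c : ℂ, (g : V ≃ₗ[ℂ] V) (E a) = c • E a) → g ∈ P) :
    D.IsSemilarge P := by
  classical
  set I := {W : Submodule ℂ V | ∀ g ∈ P, W.map ((g : V ≃ₗ[ℂ] V) : V →ₗ[ℂ] V) = W} with hI
  have hsat : ∀ W ∈ I, ∀ v ∈ W, ∀ a, E.repr v a ≠ 0 → E a ∈ W := fun W hW v hv a ha =>
    basis_mem_of_invariant hE hH hW hv ha
  let Inv : D.G → Set (Submodule ℂ V) := fun g =>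
    {W | W ∈ I ∧ W.map ((g : V ≃ₗ[ℂ] V) : V →ₗ[ℂ] V) = W}
  have hfin : (Set.range Inv).Finite := by
    refine finite_range_of_biinvariant (P := P) Inv fun p hp q hq g => ?_
    ext W
    refine and_congr_right fun hW => ?_
    rw [map_mul_eq, map_mul_eq, hW q hq]
    conv_lhs => rhs; rw [← hW p hp]
    exact (map_injective p).eq_iff
  have : Finite (Set.range Inv) := hfin
  obtain ⟨j, hj, hfix, hjE⟩ := hE.exists_involutive
  let Θ : Submodule ℂ V → Set (Set.range Inv) := fun W => {s | W ∈ s.1}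
  change I.Finite
  refine Set.Finite.of_finite_fibers Θ (Set.toFinite _) fun x _ => ?_
  rcases (I ∩ Θ ⁻¹' {x}).eq_empty_or_nonempty with h | ⟨W₀, hW₀, hx⟩
  · rw [h]; exact Set.finite_empty
  -- Two indices of equal type are exchanged by an element of `G` fixing `W₀`, hence fixing every
  -- `W` in its class. So `W` is determined by a subset of the eight types.
  let τ : ℕ → Prop × Prop × Prop := fun y => (E y ∈ W₀, E (j y) ∈ W₀, j y = y)
  let Ψ : Submodule ℂ V → Set (Prop × Prop × Prop) := fun W => τ '' {y | E y ∈ W}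
  refine Set.Finite.of_finite_image (f := Ψ) (Set.toFinite _) ?_
  have key : ∀ W ∈ I ∩ Θ ⁻¹' {x}, ∀ y, E y ∈ W ↔ τ y ∈ Ψ W := by
    rintro W ⟨hW, hWx⟩ y
    refine ⟨fun h => ⟨y, h, rfl⟩, ?_⟩
    rintro ⟨y', hy', hτ⟩
    simp only [τ, Prod.mk.injEq, eq_iff_iff] at hτ
    obtain ⟨g, hg, c, hc0, hc⟩ := exists_swap_mem hE hj hfix hjE (hsat W₀ hW₀) hτ.1 hτ.2.1 hτ.2.2
    have h1 : (⟨Inv g, g, rfl⟩ : Set.range Inv) ∈ Θ W := by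
      rw [show Θ W = Θ W₀ from hWx.trans hx.symm]
      exact ⟨hW₀, hg⟩
    have h2 : c • E y ∈ W := by
      rw [← hc, ← h1.2]
      exact ⟨E y', hy', rfl⟩
    exact (Submodule.smul_mem_iff _ hc0).1 h2
  intro W hW W' hW' hΨ
  have hiff : ∀ y, E y ∈ W ↔ E y ∈ W' := fun y => by
    rw [key W hW, key W' hW', hΨ]
  exact le_antisymm (le_of_basis_mem (hsat W hW.1) fun a => (hiff a).1)
    (le_of_basis_mem (hsat W' hW'.1) fun a => (hiff a).2)

theorem mem_span_image_iff {A : Set ℕ} {v : V} :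
    v ∈ Submodule.span ℂ (E '' A) ↔ ∀ a, E.repr v a ≠ 0 → a ∈ A := by
  rw [E.mem_span_image]
  simp [Set.subset_def]

theorem orthogonal_span_image {ω : LinearMap.BilinForm ℂ V} {i : ℕ → ℕ}
    (hi : IsBasisInvolution ω E i) (A : Set ℕ) :
    ω.orthogonal (Submodule.span ℂ (E '' A)) = Submodule.span ℂ (E '' {a | i a ∉ A}) := by
  have hco : ∀ a v, ω (E a) v = ω (E a) (E (i a)) * E.repr v (i a) := fun a v => by
    conv_lhs => rw [form_apply_eq_coord_smul hi]
    simp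
  ext v
  rw [mem_span_image_iff]
  constructor
  · intro h a ha hia
    have := h (E (i a)) (Submodule.subset_span ⟨_, hia, rfl⟩)
    change ω (E (i a)) v = 0 at this
    rw [hco, hi.1 a] at this
    exact (mul_ne_zero ((hi.2.2 _ _).2 (hi.1 a).symm) ha) this
  · intro h w hw
    change ω w v = 0
    induction hw using Submodule.span_induction with
    | mem x hx =>
      obtain ⟨a, ha, rfl⟩ := hx
      rw [hco]
      by_contra hne
      have := h (i a) (right_ne_zero_of_mul hne)
      simp only [Set.mem_ofPred_eq, hi.1 a] at this
      exact this ha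
    | zero => simp
    | add x y _ _ hx hy => simp [hx, hy]
    | smul c x _ hx => simp [hx]

/-- If `⟨A⟩` is `P`-invariant and there are finitely many double cosets, then an involution
lifting to `G` moves only finitely many elements of `A` out of `A`. -/
theorem finite_setOf_moved [Finite (MulAction.orbitRel.Quotient P (D.G ⧸ P))]
    (hE : D.IsAdmissible E) {A : Set ℕ}
    (hA : ∀ g ∈ P, (Submodule.span ℂ (E '' A)).map ((g : V ≃ₗ[ℂ] V) : V →ₗ[ℂ] V) =
      Submodule.span ℂ (E '' A)) {j : ℕ → ℕ} (hj : Function.Involutive j)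
    (hjE : ∀ ω ∈ D.form, ∀ i, IsBasisInvolution ω E i → i = j) :
    {a | a ∈ A ∧ j a ∉ A}.Finite := by
  classical
  by_contra hinf
  set W := Submodule.span ℂ (E '' A) with hWdef
  -- The dimension of `(gW + W)/W`. It is constant on double cosets: the right factor preserves `W`,
  -- and the left factor induces an automorphism of `V/W`.
  let d : D.G → ℕ := fun g => finrank ℂ ((W.map ((g : V ≃ₗ[ℂ] V) : V →ₗ[ℂ] V)).map W.mkQ)
  have hfin : (Set.range d).Finite := by
    refine finite_range_of_biinvariant (P := P) d fun p hp q hq g => ?_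
    simp only [d]
    rw [map_mul_eq, map_mul_eq, hA q hq]
    let e : (V ⧸ W) ≃ₗ[ℂ] (V ⧸ W) := Submodule.Quotient.equiv W W (p : V ≃ₗ[ℂ] V) (hA p hp)
    have : ∀ U : Submodule ℂ V, (U.map ((p : V ≃ₗ[ℂ] V) : V →ₗ[ℂ] V)).map W.mkQ =
        (U.map W.mkQ).map (e : (V ⧸ W) →ₗ[ℂ] (V ⧸ W)) := fun U => by
      rw [← Submodule.map_comp, ← Submodule.map_comp]
      rfl
    rw [this, LinearEquiv.finrank_map_eq e]
  refine Set.infinite_univ (hfin.subset ?_)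
  intro n _
  obtain ⟨T, hT, hTn⟩ := Set.Infinite.exists_subset_card_eq hinf n
  have hjj : ∀ a, j (j a) = a := hj
  -- Applying `j` on `T ∪ j(T)` only, the lift carries exactly the `n` vectors indexed by `T` out of
  -- `W`, to independent classes in `V/W`.
  set f : ℕ → ℕ := fun a => if a ∈ T ∨ j a ∈ T then j a else a with hf
  have hinv : Function.Involutive f := by
    intro a
    simp only [hf]
    grind
  let σ : Equiv.Perm ℕ := hinv.toPerm
  obtain ⟨g, hg⟩ := exists_lift_perm hE σ (T ∪ T.image j)
    (fun a ha => by
      rw [Finset.notMem_union] at ha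
      have h2 : j a ∉ T := fun h => ha.2 (Finset.mem_image.2 ⟨_, h, hjj a⟩)
      change f a = a
      simp [hf, ha.1, h2])
    (fun ω hω i hi a => by
      obtain rfl := hjE ω hω i hi
      change f (i a) = i (f a)
      simp only [hf]
      grind)
  refine ⟨g, ?_⟩
  have hT' : ∀ a ∈ T, a ∈ A ∧ j a ∉ A := fun a ha => hT ha
  have hmap : (W.map ((g : V ≃ₗ[ℂ] V) : V →ₗ[ℂ] V)).map W.mkQ =
      Submodule.span ℂ (Set.range fun a : T => W.mkQ (E (j a))) := by
    apply le_antisymm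
    · rw [hWdef, Submodule.map_span, Submodule.map_span, Submodule.span_le]
      rintro _ ⟨_, ⟨_, ⟨a, ha, rfl⟩, rfl⟩, rfl⟩
      obtain ⟨c, -, hc⟩ := hg a
      change W.mkQ ((g : V ≃ₗ[ℂ] V) (E a)) ∈ _
      rw [hc, map_smul]
      refine Submodule.smul_mem _ _ ?_
      change W.mkQ (E (f a)) ∈ _
      by_cases haT : a ∈ T
      · simp only [hf, haT, true_or, if_true]
        exact Submodule.subset_span ⟨⟨a, haT⟩, rfl⟩
      · have h2 : j a ∉ T := fun h => (hT' _ h).2 (by rwa [hjj])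
        simp only [hf, haT, h2, or_self, if_false]
        rw [(Submodule.Quotient.mk_eq_zero W).2 (Submodule.subset_span ⟨a, ha, rfl⟩) |> fun h =>
          (show W.mkQ (E a) = 0 from h)]
        exact Submodule.zero_mem _
    · rw [Submodule.span_le]
      rintro _ ⟨⟨a, ha⟩, rfl⟩
      obtain ⟨c, hc0, hc⟩ := hg a
      refine ⟨E (j a), ⟨c⁻¹ • E a, W.smul_mem _ (Submodule.subset_span ⟨a, (hT' a ha).1, rfl⟩),
        ?_⟩, rfl⟩
      change (g : V ≃ₗ[ℂ] V) _ = _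
      rw [map_smul, hc, smul_smul, inv_mul_cancel₀ hc0, one_smul]
      change E (f a) = _
      simp [hf, ha]
  have hli : LinearIndependent ℂ (fun a : T => W.mkQ (E (j a))) := by
    have h1 : LinearIndependent ℂ (fun a : T => E (j a)) :=
      E.linearIndependent.comp (fun a : T => j a) (hj.injective.comp Subtype.val_injective)
    refine h1.map (f := W.mkQ) ?_
    rw [Submodule.ker_mkQ, Submodule.disjoint_def]
    intro v hv hvW
    have h2 : v ∈ Submodule.span ℂ (E '' (j '' T)) := by
      have : E '' (j '' T) = Set.range fun a : T => E (j a) := by ext x; simp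
      rw [this]
      exact hv
    refine E.ext_elem fun a => ?_
    by_contra hne
    simp only [map_zero, Finsupp.coe_zero, Pi.zero_apply] at hne
    obtain ⟨b, hb, rfl⟩ := mem_span_image_iff.1 h2 a hne
    exact (hT' b hb).2 (mem_span_image_iff.1 hvW _ hne)
  change finrank ℂ _ = n
  rw [hmap, finrank_span_eq_card hli, Fintype.card_coe, hTn]

/-- In type (A) permutations are unconstrained, so two infinite sets `A` and `Aᶜ` could be exchanged
by an involution moving all of `A`. With a form, `⟨A⟩` is isotropic or coisotropic. In the first
case the basis involution moves all of `A` out of `A`; in the second the same applies to its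
orthogonal, whose index set is carried onto `Aᶜ` by the involution. -/
theorem finite_or_finite_compl [Finite (MulAction.orbitRel.Quotient P (D.G ⧸ P))]
    (hE : D.IsAdmissible E) {A : Set ℕ}
    (hA : ∀ g ∈ P, (Submodule.span ℂ (E '' A)).map ((g : V ≃ₗ[ℂ] V) : V →ₗ[ℂ] V) =
      Submodule.span ℂ (E '' A))
    (hA' : ∀ ω ∈ D.form, ∀ i, IsBasisInvolution ω E i →
      (A ⊆ {a | i a ∉ A} ∨ {a | i a ∉ A} ⊆ A) ∧
      ∀ g ∈ P, (Submodule.span ℂ (E '' {a | i a ∉ A})).map ((g : V ≃ₗ[ℂ] V) : V →ₗ[ℂ] V) =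
      Submodule.span ℂ (E '' {a | i a ∉ A})) : A.Finite ∨ Aᶜ.Finite := by
  classical
  rcases hf : D.form with _ | ω
  · by_contra! hinf
    obtain ⟨h1, h2⟩ := hinf
    have : Infinite A := Set.infinite_coe_iff.2 h1
    have : Infinite (Aᶜ : Set ℕ) := Set.infinite_coe_iff.2 h2
    let e : A ≃ (Aᶜ : Set ℕ) := (nonempty_equiv_of_countable (α := A) (β := (Aᶜ : Set ℕ))).some
    set j : ℕ → ℕ := fun a => if h : a ∈ A then e ⟨a, h⟩ else e.symm ⟨a, h⟩ with hj
    have hjA : ∀ a (h : a ∈ A), j a = e ⟨a, h⟩ := fun a h => by simp [hj, h]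
    have hjA' : ∀ a (h : a ∉ A), j a = e.symm ⟨a, h⟩ := fun a h => by simp [hj, h]
    have hjj : Function.Involutive j := fun a => by
      by_cases h : a ∈ A
      · rw [hjA a h, hjA' _ (e ⟨a, h⟩).2]; simp
      · rw [hjA' a h, hjA _ (e.symm ⟨a, h⟩).2]; simp
    refine h1 ((finite_setOf_moved hE hA hjj (by simp [hf])).subset fun a ha => ⟨ha, ?_⟩)
    rw [hjA a ha]
    exact (e ⟨a, ha⟩).2
  · obtain ⟨i, hI⟩ := hE.exists_involution (ω := ω) hf
    have hjE : ∀ ω ∈ D.form, ∀ i', IsBasisInvolution ω E i' → i' = i := fun ω' hω' i' hi' => by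
      obtain rfl : ω = ω' := by simpa [hf] using hω'
      exact hi'.unique hI
    obtain ⟨h1 | h1, h2⟩ := hA' ω hf i hI
    · exact Or.inl ((finite_setOf_moved hE hA hI.1 hjE).subset fun a ha => ⟨ha, h1 ha⟩)
    · right
      have h3 : {a | i a ∉ A}.Finite := (finite_setOf_moved hE h2 hI.1 hjE).subset
        fun a ha => ⟨ha, fun h => h (by rw [hI.1]; exact h1 ha)⟩
      refine (h3.image i).subset fun a ha => ⟨i a, ?_, hI.1 a⟩
      simpa [hI.1 a] using ha

theorem finiteDimensional_quotient_span_image {A : Set ℕ} (hA : Aᶜ.Finite) :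
    FiniteDimensional ℂ (V ⧸ Submodule.span ℂ (E '' A)) := by
  change Module.Finite _ _
  rw [Module.finite_def]
  have : (⊤ : Submodule ℂ (V ⧸ Submodule.span ℂ (E '' A))) =
      (Submodule.span ℂ (E '' Aᶜ)).map (Submodule.span ℂ (E '' A)).mkQ := by
    rw [eq_comm, Submodule.map_mkQ_eq_top, ← Submodule.span_union, ← Set.image_union,
      Set.union_compl_self, Set.image_univ, E.span_eq]
  rw [this]
  exact (Submodule.fg_span (hA.image E)).map _

/-- Finitely many double cosets force a splitting parabolic subgroup to be large. -/
theorem IsSplittingParabolic.isLarge_of_finite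
    [Finite (MulAction.orbitRel.Quotient P (D.G ⧸ P))] (hP : D.IsSplittingParabolic P) :
    D.IsLarge P := by
  obtain ⟨E, hE, hH, r, hrefl, htrans, htotal, hanti, hr⟩ := hP.exists_preorder
  have hsemi := isSemilarge_of_finite hE hH
  refine ⟨hsemi, ?_⟩
  let IsLow : Set ℕ → Prop := fun A => ∀ b ∈ A, ∀ a, r a b → a ∈ A
  have hlow_total : ∀ A B, IsLow A → IsLow B → A ⊆ B ∨ B ⊆ A := by
    intro A B hA hB
    by_contra! h
    obtain ⟨h1, h2⟩ := h
    obtain ⟨a, ha, ha'⟩ := Set.not_subset.1 h1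
    obtain ⟨b, hb, hb'⟩ := Set.not_subset.1 h2
    rcases htotal a b with h | h
    · exact ha' (hB b hb a h)
    · exact hb' (hA a ha b h)
  have hinv : ∀ A, IsLow A → ∀ g ∈ P,
      (Submodule.span ℂ (E '' A)).map ((g : V ≃ₗ[ℂ] V) : V →ₗ[ℂ] V) =
        Submodule.span ℂ (E '' A) := by
    intro A hA g hg
    refine map_eq_of_forall_map_le (P := P) (fun g hg => ?_) hg
    rw [Submodule.map_span, Submodule.span_le]
    rintro _ ⟨_, ⟨b, hb, rfl⟩, rfl⟩
    exact mem_span_image_iff.2 fun a ha => hA b hb a ((hr g).1 hg a b ha)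
  set 𝓓 : Set (Submodule ℂ V) := {W | ∃ A, IsLow A ∧ W = Submodule.span ℂ (E '' A)} with h𝓓
  have h𝓓fin : 𝓓.Finite := hsemi.subset (by rintro _ ⟨A, hA, rfl⟩; exact hinv A hA)
  have hbot : (⊥ : Submodule ℂ V) ∈ 𝓓 := ⟨∅, fun _ h => h.elim, by simp⟩
  have htop : (⊤ : Submodule ℂ V) ∈ 𝓓 := ⟨Set.univ, fun _ _ _ _ => trivial, by simp [E.span_eq]⟩
  obtain ⟨m, F, hmono, hrange⟩ := exists_strictMono_range_eq h𝓓fin ⟨_, hbot⟩ (by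
    rintro _ ⟨A, hA, rfl⟩ _ ⟨B, hB, rfl⟩
    exact (hlow_total A B hA hB).imp (fun h => Submodule.span_mono (Set.image_mono h))
      fun h => Submodule.span_mono (Set.image_mono h))
  have hF : ∀ k, F k ∈ 𝓓 := fun k => hrange ▸ ⟨k, rfl⟩
  have hperpLow : ∀ ω ∈ D.form, ∀ i, IsBasisInvolution ω E i → ∀ A, IsLow A →
      IsLow {a | i a ∉ A} := by
    intro ω hω i hi A hA b hb a hab h
    exact hb (hA _ h _ (hanti ω hω i hi a b hab))
  refine ⟨m, F, hmono, ?_, ?_, fun ω hω k => ?_, fun g => ⟨fun hg k => ?_, fun h => ?_⟩,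
    fun k => ?_⟩
  · obtain ⟨k, hk⟩ : ⊥ ∈ Set.range F := hrange ▸ hbot
    exact le_bot_iff.1 (hk ▸ hmono.monotone (Fin.zero_le k))
  · obtain ⟨k, hk⟩ : ⊤ ∈ Set.range F := hrange ▸ htop
    exact top_le_iff.1 (hk ▸ hmono.monotone (Fin.le_last k))
  · obtain ⟨i, hi⟩ := hE.exists_involution hω
    have hperp : ∀ W ∈ 𝓓, ω.orthogonal W ∈ 𝓓 ∧ ω.orthogonal (ω.orthogonal W) = W := by
      rintro _ ⟨A, hA, rfl⟩
      rw [orthogonal_span_image hi]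
      refine ⟨⟨_, hperpLow ω hω i hi A hA, rfl⟩, ?_⟩
      rw [orthogonal_span_image hi]
      congr 2
      ext a
      simp [hi.1 a]
    -- Two strictly increasing enumerations of the same finite chain coincide, so duality must be `k
    -- ↦ k.rev`.
    have hmono' : StrictMono fun k : Fin (m + 1) => ω.orthogonal (F k.rev) := by
      intro a b hab
      have h1 : F b.rev < F a.rev := hmono (Fin.rev_lt_rev.2 hab)
      refine lt_of_le_of_ne (LinearMap.BilinForm.orthogonal_le h1.le) fun h => h1.ne ?_
      rw [← (hperp _ (hF b.rev)).2, ← (hperp _ (hF a.rev)).2]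
      exact congrArg _ h.symm
    have heq : (fun k : Fin (m + 1) => ω.orthogonal (F k.rev)) = F := by
      refine (StrictMono.range_inj hmono' hmono).1 ?_
      rw [hrange]
      ext W
      constructor
      · rintro ⟨k, rfl⟩
        exact (hperp _ (hF _)).1
      · intro hW
        obtain ⟨k, hk⟩ : ω.orthogonal W ∈ Set.range F := hrange ▸ (hperp W hW).1
        exact ⟨k.rev, by simp only [Fin.rev_rev, hk, (hperp W hW).2]⟩
    have := congrFun heq k.rev
    simpa using this
  · obtain ⟨A, hA, hFk⟩ := hF k
    rw [hFk]
    exact hinv A hA g hg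
  · refine (hr g).2 fun a b hab => ?_
    -- The span of the principal lower set of `b` is a member of the chain, and stabilizing it
    -- bounds column `b` of `g`; this is block triangularity.
    obtain ⟨k, hk⟩ : Submodule.span ℂ (E '' {c | r c b}) ∈ Set.range F :=
      hrange ▸ ⟨_, fun x hx y hy => htrans _ _ _ hy hx, rfl⟩
    have h1 : (g : V ≃ₗ[ℂ] V) (E b) ∈ Submodule.span ℂ (E '' {c | r c b}) := by
      rw [← hk, ← h k, hk]
      exact ⟨E b, Submodule.subset_span ⟨b, hrefl b, rfl⟩, rfl⟩
    exact mem_span_image_iff.1 h1 a hab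
  · obtain ⟨A, hA, hFk⟩ := hF k
    rw [hFk]
    rcases finite_or_finite_compl hE (hinv A hA) (fun ω hω i hi =>
      ⟨hlow_total _ _ hA (hperpLow ω hω i hi A hA), hinv _ (hperpLow ω hω i hi A hA)⟩) with h | h
    · exact Or.inl (FiniteDimensional.span_of_finite ℂ (h.image E))
    · exact Or.inr (finiteDimensional_quotient_span_image h)

end Necessity

end ClassicalDatum

/-! ### Relative position of a vector with respect to a pair of flags. -/

section FlagPairs

variable {K X Y : Type*} [Field K] [AddCommGroup X] [Module K X] [AddCommGroup Y] [Module K Y]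

/-- The span of the first `k` terms of a sequence of vectors. -/
def flagOf (K : Type*) {X : Type*} [Field K] [AddCommGroup X] [Module K X] (e : ℕ → X) (k : ℕ) :
    Submodule K X :=
  Submodule.span K (e '' Set.Iio k)

theorem flagOf_zero (e : ℕ → X) : flagOf K e 0 = ⊥ := by
  simp [flagOf]

theorem flagOf_mono (e : ℕ → X) : Monotone (flagOf K e) := fun _ _ h =>
  Submodule.span_mono (Set.image_mono (Set.Iio_subset_Iio h))

theorem mem_flagOf (e : ℕ → X) {j k : ℕ} (h : j < k) : e j ∈ flagOf K e k :=
  Submodule.subset_span ⟨j, h, rfl⟩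

theorem flagOf_succ (e : ℕ → X) (k : ℕ) :
    flagOf K e (k + 1) = flagOf K e k ⊔ Submodule.span K {e k} := by
  rw [flagOf, flagOf, ← Submodule.span_union]
  congr 1
  ext x
  simp only [Set.mem_image, Set.mem_Iio, Set.mem_union, Set.mem_singleton_iff, Nat.lt_succ_iff_lt_or_eq]
  constructor
  · rintro ⟨j, h | rfl, rfl⟩
    · exact Or.inl ⟨j, h, rfl⟩
    · exact Or.inr rfl
  · rintro (⟨j, h, rfl⟩ | rfl)
    · exact ⟨j, Or.inl h, rfl⟩
    · exact ⟨k, Or.inr rfl, rfl⟩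

instance (e : ℕ → X) (k : ℕ) : FiniteDimensional K (flagOf K e k) :=
  FiniteDimensional.span_of_finite K ((Set.finite_Iio k).image e)

theorem flagOf_map (f : X ≃ₗ[K] X) (e : ℕ → X) (k : ℕ) :
    (flagOf K e k).map (f : X →ₗ[K] X) = flagOf K (fun j => f (e j)) k := by
  rw [flagOf, flagOf, Submodule.map_span, Set.image_image]
  rfl

theorem flagOf_le {e : ℕ → X} {k : ℕ} {W : Submodule K X} (h : ∀ j < k, e j ∈ W) :
    flagOf K e k ≤ W := by
  rw [flagOf, Submodule.span_le]
  rintro _ ⟨j, hj, rfl⟩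
  exact h j hj

variable (B : Y →ₗ[K] X →ₗ[K] K)

/-- A functional on `Φ` vanishing on the annihilator of a finite-dimensional `F` in `Φ` is given
by an element of `F`. -/
theorem exists_mem_eq_pairing {F : Submodule K X} [FiniteDimensional K F] (Φ : Submodule K Y)
    (l : Y →ₗ[K] K) (h : ∀ y ∈ Φ, (∀ f ∈ F, B y f = 0) → l y = 0) :
    ∃ f ∈ F, ∀ y ∈ Φ, l y = B y f := by
  let b := Module.finBasis K F
  let L : Fin (finrank K F) → (Φ →ₗ[K] K) := fun i => (B.flip (b i : X)) ∘ₗ Φ.subtype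
  have hmem : l ∘ₗ Φ.subtype ∈ Submodule.span K (Set.range L) := by
    refine mem_span_of_iInf_ker_le_ker fun y hy => ?_
    refine h y y.2 fun f hf => ?_
    have hy' : ∀ i, B y (b i : X) = 0 := fun i => (Submodule.mem_iInf _).1 hy i
    have := congrArg Subtype.val (b.sum_repr ⟨f, hf⟩)
    simp only [Submodule.coe_sum, Submodule.coe_smul] at this
    rw [← this, map_sum]
    exact Finset.sum_eq_zero fun i _ => by rw [map_smul, hy', smul_zero]
  obtain ⟨c, hc⟩ := (Submodule.mem_span_range_iff_exists_fun K).1 hmem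
  refine ⟨∑ i, c i • (b i : X), F.sum_mem fun i _ => F.smul_mem _ (b i).2, fun y hy => ?_⟩
  have := LinearMap.congr_fun hc ⟨y, hy⟩
  simp only [LinearMap.coe_sum, Finset.sum_apply, LinearMap.smul_apply, L] at this
  simpa using this.symm

variable {B}

/-- Otherwise evaluation at `v` vanishes on the annihilator of `W` in `A`, hence agrees on `A` with
some `f ∈ W`; then `A` does not separate `v` from `f`. -/
theorem exists_separating {A : Submodule K Y} (hA : ∀ v, v ≠ 0 → ∃ y ∈ A, B y v ≠ 0)
    {W : Submodule K X} [FiniteDimensional K W] {v : X} (hv : v ∉ W) :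
    ∃ x ∈ A, (∀ w ∈ W, B x w = 0) ∧ B x v = 1 := by
  by_contra! hcon
  have h0 : ∀ y ∈ A, (∀ f ∈ W, B y f = 0) → B.flip v y = 0 := fun y hy h => by
    by_contra hne
    refine hcon ((B y v)⁻¹ • y) (A.smul_mem _ hy) (fun w hw => ?_) ?_
    · simp [h w hw]
    · simp only [map_smul, LinearMap.smul_apply, smul_eq_mul]
      exact inv_mul_cancel₀ hne
  obtain ⟨f, hf, hfv⟩ := exists_mem_eq_pairing B A (B.flip v) h0
  have : v - f = 0 := by
    by_contra hne
    obtain ⟨y, hy, hy'⟩ := hA _ hne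
    refine hy' ?_
    rw [map_sub, sub_eq_zero]
    exact hfv y hy
  exact hv (sub_eq_zero.1 this ▸ hf)

theorem exists_separating_two {A : Submodule K Y} (hA : ∀ v, v ≠ 0 → ∃ y ∈ A, B y v ≠ 0)
    {W : Submodule K X} [FiniteDimensional K W] {v v' : X} (hv : v ∉ W) (hv' : v' ∉ W) :
    ∃ x ∈ A, (∀ w ∈ W, B x w = 0) ∧ B x v = 1 ∧ B x v' ≠ 0 := by
  obtain ⟨x, hx, hxW, hxv⟩ := exists_separating hA hv
  by_cases h : B x v' = 0
  · obtain ⟨y, hy, hyW, hyv⟩ := exists_separating hA hv'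
    by_cases h' : B y v = 0
    · exact ⟨x + y, A.add_mem hx hy, fun w hw => by simp [hxW w hw, hyW w hw],
        by simp [hxv, h'], by simp [h, hyv]⟩
    · refine ⟨(B y v)⁻¹ • y, A.smul_mem _ hy, fun w hw => by simp [hyW w hw], ?_, ?_⟩
      · simp only [map_smul, LinearMap.smul_apply, smul_eq_mul]
        exact inv_mul_cancel₀ h'
      · simp [hyv, h']
  · exact ⟨x, hx, hxW, hxv, h⟩

variable (B) in
/-- The relative position of `v` modulo `F` with respect to a flag in `X` and a flag in `Y`. -/
def relPos (e : ℕ → X) (φ : ℕ → Y) (p q : ℕ) (F : Submodule K X) (v : X) :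
    Set (Fin (p + 1)) × Set (Fin (q + 1)) :=
  ({i | v ∈ flagOf K e i ⊔ F},
    {j | ∀ y ∈ flagOf K φ j, (∀ f ∈ F, B y f = 0) → B y v = 0})

/-- Normalization of two vectors having the same relative position. -/
theorem exists_normalization_of_relPos_eq {e : ℕ → X} {φ : ℕ → Y} {p q : ℕ} {F : Submodule K X}
    [FiniteDimensional K F] {v v' : X} (h : relPos B e φ p q F v = relPos B e φ p q F v') :
    ∃ (w w' : X) (c : K), c ≠ 0 ∧ w - v ∈ F ∧ w' - c • v' ∈ F ∧
      ((w = 0 ∧ w' = 0) ∨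
      (∃ i < p, w ∈ flagOf K e (i + 1) ∧ w' ∈ flagOf K e (i + 1) ∧ w' - w ∈ flagOf K e i ∧
        w ∉ flagOf K e i ⊔ F) ∨
      (w ∉ flagOf K e p ⊔ F ∧ w' ∉ flagOf K e p ⊔ F ∧
        ∀ y ∈ flagOf K φ q, B y w = 0 ∧ B y w' = 0) ∨
      (∃ j < q, ∃ x ∈ flagOf K φ (j + 1), (∀ f ∈ F, B x f = 0) ∧ B x w = 1 ∧ B x w' = 1 ∧
        ∀ y ∈ flagOf K φ j, B y (w' - w) = 0)) := by
  have h1 : ∀ i ≤ p, v ∈ flagOf K e i ⊔ F ↔ v' ∈ flagOf K e i ⊔ F := fun i hi =>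
    Set.ext_iff.1 (congrArg Prod.fst h) ⟨i, Nat.lt_succ_of_le hi⟩
  have h2 : ∀ j ≤ q, (∀ y ∈ flagOf K φ j, (∀ f ∈ F, B y f = 0) → B y v = 0) ↔
      (∀ y ∈ flagOf K φ j, (∀ f ∈ F, B y f = 0) → B y v' = 0) := fun j hj =>
    Set.ext_iff.1 (congrArg Prod.snd h) ⟨j, Nat.lt_succ_of_le hj⟩
  by_cases hE : v ∈ flagOf K e p ⊔ F
  · classical
    have hex : ∃ i, i ≤ p ∧ v ∈ flagOf K e i ⊔ F := ⟨p, le_rfl, hE⟩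
    obtain ⟨hip, hi⟩ := Nat.find_spec hex
    have hmin := fun k => Nat.find_min (H := hex) (m := k)
    rcases hi0 : Nat.find hex with _ | i
    · rw [hi0, flagOf_zero, bot_sup_eq] at hi
      have hv' := (h1 0 (Nat.zero_le _)).1 (by rwa [flagOf_zero, bot_sup_eq])
      rw [flagOf_zero, bot_sup_eq] at hv'
      exact ⟨0, 0, 1, one_ne_zero, by simpa using hi, by simpa using hv', Or.inl ⟨rfl, rfl⟩⟩
    · rw [hi0] at hi hip hmin
      have hvi : v ∉ flagOf K e i ⊔ F := fun h => hmin i (Nat.lt_succ_self i) ⟨by omega, h⟩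
      have hvi' : v' ∉ flagOf K e i ⊔ F := fun h => hvi ((h1 i (by omega)).2 h)
      have hi' := (h1 _ hip).1 hi
      obtain ⟨x, hx, f, hf, rfl⟩ := Submodule.mem_sup.1 hi
      obtain ⟨x', hx', f', hf', rfl⟩ := Submodule.mem_sup.1 hi'
      have hx0 := hx
      have hx0' := hx'
      rw [flagOf_succ] at hx hx'
      obtain ⟨y, hy, z, hz, rfl⟩ := Submodule.mem_sup.1 hx
      obtain ⟨y', hy', z', hz', rfl⟩ := Submodule.mem_sup.1 hx'
      obtain ⟨a, rfl⟩ := Submodule.mem_span_singleton.1 hz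
      obtain ⟨a', rfl⟩ := Submodule.mem_span_singleton.1 hz'
      have ha : a ≠ 0 := by
        rintro rfl
        rw [zero_smul, add_zero] at hvi
        exact hvi (Submodule.add_mem_sup hy hf)
      have ha' : a' ≠ 0 := by
        rintro rfl
        rw [zero_smul, add_zero] at hvi'
        exact hvi' (Submodule.add_mem_sup hy' hf')
      -- The first flag step reaching `v` modulo `F` is the same for `v'`. Scaling by `a / a'`
      -- equalizes the coefficients of `e i`, so the difference drops one step.
      refine ⟨y + a • e i, (a / a') • (y' + a' • e i), a / a', div_ne_zero ha ha', ?_, ?_,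
        Or.inr (Or.inl ⟨i, by omega, hx0, Submodule.smul_mem _ _ hx0', ?_, fun hw => ?_⟩)⟩
      · simpa using hf
      · rw [← smul_sub]
        exact F.smul_mem _ (by simpa using hf')
      · have : (a / a') • (y' + a' • e i) - (y + a • e i) = (a / a') • y' - y := by
          rw [smul_add, smul_smul, div_mul_cancel₀ _ ha']
          abel
        rw [this]
        exact Submodule.sub_mem _ (Submodule.smul_mem _ _ hy') hy
      · exact hvi (Submodule.add_mem _ hw (Submodule.mem_sup_right hf))
  · have hE' : v' ∉ flagOf K e p ⊔ F := fun h => hE ((h1 p le_rfl).2 h)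
    by_cases hφ : ∀ y ∈ flagOf K φ q, (∀ f ∈ F, B y f = 0) → B y v = 0
    -- The functionals annihilating `F` do not see `v`, so on the whole flag of functionals `v` acts
    -- like an element of `F`, which is subtracted.
    · obtain ⟨f, hf, hfv⟩ := exists_mem_eq_pairing B (flagOf K φ q) (B.flip v) hφ
      obtain ⟨f', hf', hfv'⟩ := exists_mem_eq_pairing B (flagOf K φ q) (B.flip v')
        ((h2 q le_rfl).1 hφ)
      refine ⟨v - f, v' - f', 1, one_ne_zero, by simpa using hf, by simpa using hf',
        Or.inr (Or.inr (Or.inl ⟨fun hw => hE ?_, fun hw => hE' ?_, fun y hy => ⟨?_, ?_⟩⟩))⟩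
      · simpa using Submodule.add_mem _ hw (Submodule.mem_sup_right hf)
      · simpa using Submodule.add_mem _ hw (Submodule.mem_sup_right hf')
      · rw [map_sub, sub_eq_zero]; exact hfv y hy
      · rw [map_sub, sub_eq_zero]; exact hfv' y hy
    · classical
      have hex : ∃ j, j ≤ q ∧ ¬ ∀ y ∈ flagOf K φ j, (∀ f ∈ F, B y f = 0) → B y v = 0 :=
        ⟨q, le_rfl, hφ⟩
      obtain ⟨hjq, hj⟩ := Nat.find_spec hex
      have hmin := fun k => Nat.find_min (H := hex) (m := k)
      rcases hj0 : Nat.find hex with _ | j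
      · rw [hj0] at hj
        refine absurd (fun y hy _ => ?_) hj
        rw [flagOf_zero, Submodule.mem_bot] at hy
        simp [hy]
      · rw [hj0] at hj hjq hmin
        have hv : ∀ y ∈ flagOf K φ j, (∀ f ∈ F, B y f = 0) → B y v = 0 := by
          by_contra hcon
          exact hmin j (Nat.lt_succ_self j) ⟨by omega, hcon⟩
        have hv' := (h2 j (by omega)).1 hv
        have hj' := fun h => hj ((h2 _ hjq).2 h)
        push Not at hj
        obtain ⟨x, hx, hxF, hxv⟩ := hj
        -- Among functionals annihilating `F`, passing from step `j` to step `j + 1` adds at most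
        -- one dimension, spanned by `x`. If `x` killed `v'`, all of them would, contrary to the
        -- equality of positions.
        have hxv' : B x v' ≠ 0 := by
          intro hxv'
          refine hj' fun y hy hyF => ?_
          have hx1 := hx
          rw [flagOf_succ] at hx1 hy
          obtain ⟨y0, hy0, z, hz, rfl⟩ := Submodule.mem_sup.1 hy
          obtain ⟨x0, hx0, z', hz', rfl⟩ := Submodule.mem_sup.1 hx1
          obtain ⟨a, rfl⟩ := Submodule.mem_span_singleton.1 hz
          obtain ⟨a', rfl⟩ := Submodule.mem_span_singleton.1 hz'
          have ha' : a' ≠ 0 := by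
            rintro rfl
            rw [zero_smul, add_zero] at hxv hxF
            exact hxv (hv x0 hx0 hxF)
          have hcomb : y0 + a • φ j = (y0 - (a / a') • x0) + (a / a') • (x0 + a' • φ j) := by
            rw [smul_add, smul_smul, div_mul_cancel₀ _ ha']
            abel
          have hd : y0 - (a / a') • x0 = (y0 + a • φ j) - (a / a') • (x0 + a' • φ j) := by
            rw [hcomb]; abel
          have h3 : B (y0 - (a / a') • x0) v' = 0 := by
            refine hv' _ (Submodule.sub_mem _ hy0 (Submodule.smul_mem _ _ hx0)) fun f hf => ?_
            rw [hd, map_sub, map_smul, LinearMap.sub_apply, LinearMap.smul_apply, hyF f hf,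
              hxF f hf, smul_zero, sub_zero]
          rw [hcomb, map_add, map_smul, LinearMap.add_apply, LinearMap.smul_apply, h3, hxv',
            smul_zero, add_zero]
        -- After scaling, the two vectors differ on `flagOf K φ j` only by an element of `F`, which
        -- is absorbed into `w'`.
        obtain ⟨f, hf, hfv⟩ := exists_mem_eq_pairing B (flagOf K φ j)
          (B.flip (v - (B x v / B x v') • v')) (fun y hy hyF => by
            change B y (v - _) = 0
            rw [map_sub, map_smul, hv y hy hyF, hv' y hy hyF, smul_zero, sub_zero])
        refine ⟨v, (B x v / B x v') • v' + f, B x v / B x v', div_ne_zero hxv hxv', by simp,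
          by simpa using hf, Or.inr (Or.inr (Or.inr ⟨j, by omega, (B x v)⁻¹ • x,
            Submodule.smul_mem _ _ hx, fun f hf => by simp [hxF f hf], ?_, ?_,
            fun y hy => ?_⟩))⟩
        · simp [hxv]
        · simp only [map_smul, map_add, LinearMap.smul_apply, smul_eq_mul, hxF f hf]
          field_simp
          simp
        · have := hfv y hy
          change B y (v - _) = _ at this
          simp only [map_sub, map_add] at this ⊢
          linear_combination -this

end FlagPairs

/-! ### Matching flags step by step by group elements. -/

section FlagAction

variable {K X Y Γ : Type*} [Field K] [AddCommGroup X] [Module K X] [AddCommGroup Y] [Module K Y]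
  [Group Γ]

theorem map_rep_mul (ρ : Γ →* (X ≃ₗ[K] X)) (g h : Γ) (W : Submodule K X) :
    W.map (ρ (g * h) : X →ₗ[K] X) = (W.map (ρ h : X →ₗ[K] X)).map (ρ g : X →ₗ[K] X) := by
  rw [← Submodule.map_comp, map_mul]
  rfl

theorem map_rep_one (ρ : Γ →* (X ≃ₗ[K] X)) (W : Submodule K X) :
    W.map (ρ 1 : X →ₗ[K] X) = W := by
  rw [map_one]
  exact Submodule.map_id W

/-- The stabilizer of the flag spanned by the initial segments of a sequence of vectors. -/
def flagStab (ρ : Γ →* (X ≃ₗ[K] X)) (e : ℕ → X) : Subgroup Γ where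
  carrier := {g | ∀ k, (flagOf K e k).map (ρ g : X →ₗ[K] X) = flagOf K e k}
  one_mem' k := map_rep_one ρ _
  mul_mem' {g h} hg hh k := by rw [map_rep_mul, hh, hg]
  inv_mem' {g} hg k := by
    conv_lhs => rw [← hg k, ← map_rep_mul, inv_mul_cancel, map_rep_one]

theorem mem_flagStab_of_forall_mem {ρ : Γ →* (X ≃ₗ[K] X)} {e : ℕ → X} {g : Γ}
    (h : ∀ k, ∀ z ∈ flagOf K e k, ρ g z ∈ flagOf K e k) : g ∈ flagStab ρ e := fun k =>
  Submodule.eq_of_le_of_finrank_eq (Submodule.map_le_iff_le_comap.2 (h k))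
    (LinearEquiv.finrank_map_eq (ρ g) _)

theorem map_eq_of_forall_fixed {ρ : Γ →* (X ≃ₗ[K] X)} {g : Γ} {W : Submodule K X}
    (h : ∀ f ∈ W, ρ g f = f) : W.map (ρ g : X →ₗ[K] X) = W := by
  ext x
  constructor
  · rintro ⟨f, hf, rfl⟩
    change ρ g f ∈ W
    rwa [h f hf]
  · intro hx
    exact ⟨x, hx, h x hx⟩

theorem relPos_map {ρ : Γ →* (X ≃ₗ[K] X)} {τ : Γ →* (Y ≃ₗ[K] Y)} {B : Y →ₗ[K] X →ₗ[K] K}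
    (hB : ∀ g y x, B (τ g y) (ρ g x) = B y x) {e : ℕ → X} {φ : ℕ → Y} {p q : ℕ} {b : Γ}
    (hb : b ∈ flagStab ρ e) (hb' : b ∈ flagStab τ φ) (F : Submodule K X) (v : X) :
    relPos B e φ p q (F.map (ρ b : X →ₗ[K] X)) (ρ b v) = relPos B e φ p q F v := by
  refine Prod.ext (Set.ext fun i => ?_) (Set.ext fun j => ?_)
  · change ρ b v ∈ flagOf K e i ⊔ F.map (ρ b : X →ₗ[K] X) ↔ v ∈ flagOf K e i ⊔ F
    conv_lhs => rw [← hb i, ← Submodule.map_sup]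
    constructor
    · rintro ⟨x, hx, hxv⟩
      rwa [← (ρ b).injective hxv]
    · intro h
      exact ⟨v, h, rfl⟩
  · change (∀ y ∈ flagOf K φ j, (∀ f ∈ F.map (ρ b : X →ₗ[K] X), B y f = 0) → B y (ρ b v) = 0) ↔
      (∀ y ∈ flagOf K φ j, (∀ f ∈ F, B y f = 0) → B y v = 0)
    constructor
    · intro h y hy hyF
      rw [← hB b]
      refine h (τ b y) (by rw [← hb' j]; exact ⟨y, hy, rfl⟩) ?_
      rintro _ ⟨f, hf, rfl⟩
      exact (hB b y f).trans (hyF f hf)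
    · intro h y hy hyF
      rw [← hb' j] at hy
      obtain ⟨y, hy, rfl⟩ := hy
      refine (hB b y v).trans (h y hy fun f hf => ?_)
      rw [← hB b]
      exact hyF _ ⟨f, hf, rfl⟩

/-- Flags with equal positions are matched step by step. -/
theorem exists_mul_map_flag_eq {κ : Type*} (ρ : Γ →* (X ≃ₗ[K] X)) (e : ℕ → X) (H : Subgroup Γ)
    (code : Submodule K X → X → κ)
    (hcode : ∀ b ∈ H, ∀ F v, code (F.map (ρ b : X →ₗ[K] X)) (ρ b v) = code F v) (g h : Γ) (n : ℕ)
    (hstep : ∀ b ∈ H, ∀ k < n,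
      (flagOf K e k).map (ρ (b * g) : X →ₗ[K] X) = (flagOf K e k).map (ρ h : X →ₗ[K] X) →
      code ((flagOf K e k).map (ρ h : X →ₗ[K] X)) (ρ (b * g) (e k)) =
        code ((flagOf K e k).map (ρ h : X →ₗ[K] X)) (ρ h (e k)) →
      ∃ b' ∈ H, (∀ f ∈ (flagOf K e k).map (ρ h : X →ₗ[K] X), ρ b' f = f) ∧
        ∃ c : K, c ≠ 0 ∧ ρ b' (ρ (b * g) (e k)) - c • ρ h (e k) ∈
          (flagOf K e k).map (ρ h : X →ₗ[K] X))
    (hgh : ∀ k < n, code ((flagOf K e k).map (ρ g : X →ₗ[K] X)) (ρ g (e k)) =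
      code ((flagOf K e k).map (ρ h : X →ₗ[K] X)) (ρ h (e k))) :
    ∃ b ∈ H, ∀ k ≤ n, (flagOf K e k).map (ρ (b * g) : X →ₗ[K] X) =
      (flagOf K e k).map (ρ h : X →ₗ[K] X) := by
  induction n with
  | zero =>
    refine ⟨1, H.one_mem, fun k hk => ?_⟩
    obtain rfl : k = 0 := by omega
    rw [flagOf_zero, Submodule.map_bot, Submodule.map_bot]
  | succ n ih =>
    obtain ⟨b, hb, hbk⟩ := ih (fun b hb k hk => hstep b hb k (by omega))
      fun k hk => hgh k (by omega)
    have hn := hbk n le_rfl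
    have hc : code ((flagOf K e n).map (ρ h : X →ₗ[K] X)) (ρ (b * g) (e n)) =
        code ((flagOf K e n).map (ρ h : X →ₗ[K] X)) (ρ h (e n)) := by
      rw [← hgh n (Nat.lt_succ_self n), ← hn, map_rep_mul, map_mul]
      exact hcode b hb _ _
    obtain ⟨b', hb', hfix, c, hc0, hmem⟩ := hstep b hb n (Nat.lt_succ_self n) hn hc
    refine ⟨b' * b, H.mul_mem hb' hb, fun k hk => ?_⟩
    -- The new element fixes the already matched subspace pointwise, so the earlier matches survive.
    have hle : ∀ k ≤ n, (flagOf K e k).map (ρ (b' * b * g) : X →ₗ[K] X) =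
        (flagOf K e k).map (ρ h : X →ₗ[K] X) := fun k hk => by
      rw [mul_assoc, map_rep_mul, hbk k hk]
      exact map_eq_of_forall_fixed fun f hf =>
        hfix f (Submodule.map_mono (flagOf_mono e hk) hf)
    rcases Nat.lt_succ_iff_lt_or_eq.1 (Nat.lt_succ_of_le hk) with hk | rfl
    · exact hle k (by omega)
    · rw [flagOf_succ, Submodule.map_sup, Submodule.map_sup, hle n le_rfl, Submodule.map_span,
        Submodule.map_span, Set.image_singleton, Set.image_singleton]
      set F := (flagOf K e n).map (ρ h : X →ₗ[K] X)
      have h1 : (ρ (b' * b * g) : X →ₗ[K] X) (e n) = ρ b' (ρ (b * g) (e n)) := by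
        rw [mul_assoc, map_mul]
        rfl
      rw [h1]
      apply le_antisymm
      · refine sup_le le_sup_left ?_
        rw [Submodule.span_singleton_le_iff_mem]
        have := Submodule.add_mem _ (Submodule.mem_sup_left hmem) (Submodule.mem_sup_right
          (Submodule.smul_mem _ c (Submodule.mem_span_singleton_self (ρ h (e n)))))
        simpa using this
      · refine sup_le le_sup_left ?_
        rw [Submodule.span_singleton_le_iff_mem]
        have h2 : c • ρ h (e n) ∈ F ⊔ Submodule.span K {ρ b' (ρ (b * g) (e n))} := by
          have := Submodule.sub_mem (F ⊔ Submodule.span K {ρ b' (ρ (b * g) (e n))})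
            (Submodule.mem_sup_right (Submodule.mem_span_singleton_self _))
            (Submodule.mem_sup_left hmem)
          simpa using this
        exact (Submodule.smul_mem_iff _ hc0).1 h2

/-- One step of the matching of two flags by transvections of a dual pair. -/
theorem exists_step_of_transvections {ρ : Γ →* (X ≃ₗ[K] X)} {τ : Γ →* (Y ≃ₗ[K] Y)}
    {B : Y →ₗ[K] X →ₗ[K] K} {AX : Submodule K X} {AY : Submodule K Y}
    (hT : ∀ x ∈ AY, ∀ u ∈ AX, B x u = 0 →
      ∃ g : Γ, (∀ z, ρ g z = z + B x z • u) ∧ ∀ y, τ g y = y - B y u • x)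
    (hsep : ∀ v, v ≠ 0 → ∃ y ∈ AY, B y v ≠ 0)
    {e : ℕ → X} {φ : ℕ → Y} {p q : ℕ} (hφA : ∀ k, φ k ∈ AY)
    (hp : ∀ k, flagOf K e k ≤ flagOf K e p) (hq : ∀ k, flagOf K φ k ≤ flagOf K φ q)
    (horth : ∀ y ∈ flagOf K φ q, ∀ z ∈ flagOf K e p, B y z = 0)
    {F : Submodule K X} [FiniteDimensional K F] (hFA : F ≤ AX) {Ψ : Submodule K Y} {v v' : X}
    (hv : v ∈ AX) (hv' : v' ∈ AX) (hΨF : ∀ y ∈ Ψ, ∀ f ∈ F, B y f = 0) (hΨ : ∀ y ∈ Ψ, B y v = 0)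
    (hΨ' : ∀ y ∈ Ψ, B y v' = 0) (h : relPos B e φ p q F v = relPos B e φ p q F v') :
    ∃ g ∈ flagStab ρ e ⊓ flagStab τ φ, (∀ f ∈ F, ρ g f = f) ∧ (∀ y ∈ Ψ, τ g y = y) ∧
      ∃ c : K, c ≠ 0 ∧ ρ g v - c • v' ∈ F := by
  obtain ⟨w, w', c, hc, hw, hw', hcase⟩ := exists_normalization_of_relPos_eq h
  have hwA : w ∈ AX := by simpa using AX.add_mem (hFA hw) hv
  have hwA' : w' ∈ AX := by simpa using AX.add_mem (hFA hw') (AX.smul_mem c hv')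
  -- `Ψ` is a part of the other side that must stay fixed pointwise; it does, because the direction
  -- `u` of the transvection pairs to zero with `Ψ`.
  have hwΨ : ∀ y ∈ Ψ, B y w = 0 := fun y hy => by
    have := hΨF y hy _ hw
    rwa [map_sub, hΨ y hy, sub_zero] at this
  have hwΨ' : ∀ y ∈ Ψ, B y w' = 0 := fun y hy => by
    have := hΨF y hy _ hw'
    rwa [map_sub, map_smul, hΨ' y hy, smul_zero, sub_zero] at this
  have hfinish : ∀ (g : Γ) (t : K), t ≠ 0 → (∀ f ∈ F, ρ g f = f) → ρ g w = t • w' →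
      ∃ c : K, c ≠ 0 ∧ ρ g v - c • v' ∈ F := fun g t ht hgF hgw => by
    refine ⟨t * c, mul_ne_zero ht hc, ?_⟩
    have h1 : ρ g v = t • w' - (w - v) := by
      rw [← hgw, ← hgF _ hw, ← map_sub, sub_sub_cancel]
    have h2 : ρ g v - (t * c) • v' = t • (w' - c • v') - (w - v) := by
      rw [h1, smul_sub, smul_smul]; abel
    rw [h2]
    exact F.sub_mem (F.smul_mem _ hw') hw
  rcases hcase with ⟨rfl, rfl⟩ | ⟨i, hi, hwi, hwi', hu, hwF⟩ | ⟨hwE, hwE', hφ⟩ |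
    ⟨j, hj, x, hx, hxF, hxw, hxw', hu⟩
  · refine ⟨1, one_mem _, fun f _ => by rw [map_one]; rfl, fun y _ => by rw [map_one]; rfl,
      hfinish 1 1 one_ne_zero (fun f _ => by rw [map_one]; rfl) (by simp)⟩
  -- Here `u = w' - w` lies in step `i` and `x` kills that step: smaller steps are fixed pointwise,
  -- and larger ones absorb `u`.
  · obtain ⟨x, hxA, hxW, hxw⟩ := exists_separating hsep hwF
    have hxu : B x (w' - w) = 0 := hxW _ (Submodule.mem_sup_left hu)
    obtain ⟨g, hg, hg'⟩ := hT x hxA (w' - w) (AX.sub_mem hwA' hwA) hxu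
    have hgF : ∀ f ∈ F, ρ g f = f := fun f hf => by
      rw [hg, hxW f (Submodule.mem_sup_right hf), zero_smul, add_zero]
    refine ⟨g, ⟨mem_flagStab_of_forall_mem fun k z hz => ?_,
      mem_flagStab_of_forall_mem fun k y hy => ?_⟩, hgF, fun y hy => ?_,
      hfinish g 1 one_ne_zero hgF ?_⟩
    · rw [hg]
      by_cases hk : k ≤ i
      · rwa [hxW z (Submodule.mem_sup_left (flagOf_mono e hk hz)), zero_smul, add_zero]
      · exact Submodule.add_mem _ hz (Submodule.smul_mem _ _ (flagOf_mono e (by omega) hu))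
    · rw [hg', horth y (hq k hy) _ (hp i hu), zero_smul, sub_zero]
      exact hy
    · rw [hg', map_sub, hwΨ y hy, hwΨ' y hy, sub_zero, zero_smul, sub_zero]
    · rw [hg, hxw, one_smul, one_smul, add_sub_cancel]
  -- Both flags are fixed pointwise: `x` kills the flag in `X`, and `u` is killed by the flag in
  -- `Y`. The factor `t` is needed to get `B x u = 0`.
  · obtain ⟨x, hxA, hxW, hxw, hxw'⟩ := exists_separating_two hsep hwE hwE'
    set t := (B x w')⁻¹ with ht
    have hxu : B x (t • w' - w) = 0 := by
      rw [map_sub, map_smul, hxw, smul_eq_mul, ht, inv_mul_cancel₀ hxw', sub_self]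
    obtain ⟨g, hg, hg'⟩ := hT x hxA (t • w' - w) (AX.sub_mem (AX.smul_mem _ hwA') hwA) hxu
    have hgF : ∀ f ∈ F, ρ g f = f := fun f hf => by
      rw [hg, hxW f (Submodule.mem_sup_right hf), zero_smul, add_zero]
    refine ⟨g, ⟨mem_flagStab_of_forall_mem fun k z hz => ?_,
      mem_flagStab_of_forall_mem fun k y hy => ?_⟩, hgF, fun y hy => ?_,
      hfinish g t (inv_ne_zero hxw') hgF ?_⟩
    · rwa [hg, hxW z (Submodule.mem_sup_left (hp k hz)), zero_smul, add_zero]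
    · have := hφ y (hq k hy)
      rwa [hg', map_sub, map_smul, this.1, this.2, smul_zero, sub_zero, zero_smul, sub_zero]
    · rw [hg', map_sub, map_smul, hwΨ y hy, hwΨ' y hy, smul_zero, sub_zero, zero_smul, sub_zero]
    · rw [hg, hxw, one_smul, add_sub_cancel]
  -- The mirror image of the case where `u` lies in the flag: now `x` lies in step `j + 1` of the
  -- flag in `Y`, and step `j` kills `u`.
  · have hxA : x ∈ AY := flagOf_le (fun k _ => hφA k) hx
    have hxu : B x (w' - w) = 0 := by rw [map_sub, hxw, hxw', sub_self]
    obtain ⟨g, hg, hg'⟩ := hT x hxA (w' - w) (AX.sub_mem hwA' hwA) hxu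
    have hgF : ∀ f ∈ F, ρ g f = f := fun f hf => by
      rw [hg, hxF f hf, zero_smul, add_zero]
    refine ⟨g, ⟨mem_flagStab_of_forall_mem fun k z hz => ?_,
      mem_flagStab_of_forall_mem fun k y hy => ?_⟩, hgF, fun y hy => ?_,
      hfinish g 1 one_ne_zero hgF ?_⟩
    · rwa [hg, horth x (hq _ hx) z (hp k hz), zero_smul, add_zero]
    · rw [hg']
      by_cases hk : k ≤ j
      · rwa [hu y (flagOf_mono φ hk hy), zero_smul, sub_zero]
      · exact Submodule.sub_mem _ hy (Submodule.smul_mem _ _ (flagOf_mono φ (by omega) hx))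
    · rw [hg', map_sub, hwΨ y hy, hwΨ' y hy, sub_zero, zero_smul, sub_zero]
    · rw [hg, hxw, one_smul, one_smul, add_sub_cancel]

end FlagAction

theorem flagOf_le_of_eventually_zero {K X : Type*} [Field K] [AddCommGroup X] [Module K X]
    {e : ℕ → X} {p : ℕ} (h : ∀ k ≥ p, e k = 0) (k : ℕ) : flagOf K e k ≤ flagOf K e p :=
  flagOf_le fun j _ => by
    by_cases hj : j < p
    · exact mem_flagOf e hj
    · rw [h j (not_lt.1 hj)]
      exact Submodule.zero_mem _

/-- A sequence of vectors whose initial segments span the finite-dimensional members, with index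
in `t`, of a chain of subspaces. -/
theorem exists_flagOf_refinement {K X : Type*} [Field K] [AddCommGroup X] [Module K X]
    (F : ℕ → Submodule K X) (hF : Monotone F) (t : Set ℕ)
    (ht : ∀ k ∈ t, FiniteDimensional K (F k)) (n : ℕ) :
    ∃ (e : ℕ → X) (p : ℕ), (∀ k ≥ p, e k = 0) ∧ (∀ k, e k = 0 ∨ ∃ j < n, j ∈ t ∧ e k ∈ F j) ∧
      ∀ j < n, j ∈ t → ∃ i, F j = flagOf K e i := by
  classical
  suffices ∃ (e : ℕ → X) (p : ℕ), (∀ k ≥ p, e k = 0) ∧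
      (∀ k, e k = 0 ∨ ∃ j < n, j ∈ t ∧ e k ∈ F j) ∧
      ∀ j < n, j ∈ t → ∃ i ≤ p, F j = flagOf K e i by
    obtain ⟨e, p, h1, h2, h3⟩ := this
    exact ⟨e, p, h1, h2, fun j hj hjt => (h3 j hj hjt).imp fun i hi => hi.2⟩
  induction n with
  | zero => exact ⟨0, 0, fun _ _ => rfl, fun _ => Or.inl rfl, fun _ h => absurd h (by omega)⟩
  | succ n ih =>
    obtain ⟨e, p, h1, h2, h3⟩ := ih
    by_cases hn : n ∈ t
    · have := ht n hn
      let b := Module.finBasis K (F n)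
      set d := finrank K (F n)
      -- A basis of `F n` is appended after the earlier terms. Redundant vectors are harmless
      -- because only spans matter, and the zero tail makes the flag stationary from `p + d` on.
      let e' : ℕ → X := fun k => if k < p then e k else if h : k - p < d then b ⟨k - p, h⟩ else 0
      have he : ∀ i ≤ p, flagOf K e' i = flagOf K e i := fun i hi => by
        rw [flagOf, flagOf]
        congr 1
        refine Set.image_congr fun k hk => ?_
        simp only [e', if_pos (lt_of_lt_of_le (Set.mem_Iio.1 hk) hi)]
      have heF : ∀ k, e' k = 0 ∨ ∃ j < n + 1, j ∈ t ∧ e' k ∈ F j := fun k => by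
        by_cases hk : k < p
        · simp only [e', if_pos hk]
          exact (h2 k).imp_right fun ⟨j, hj, h⟩ => ⟨j, by omega, h⟩
        · by_cases hkd : k - p < d
          · right
            simp only [e', if_neg hk, dif_pos hkd]
            exact ⟨n, by omega, hn, (b _).2⟩
          · left
            simp only [e', if_neg hk, dif_neg hkd]
      refine ⟨e', p + d, fun k hk => ?_, heF, fun j hj hjt => ?_⟩
      · simp only [e', if_neg (show ¬ k < p by omega), dif_neg (show ¬ k - p < d by omega)]
      · rcases Nat.lt_succ_iff_lt_or_eq.1 hj with hj | rfl
        · obtain ⟨i, hi, h⟩ := h3 j hj hjt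
          exact ⟨i, by omega, h.trans (he i hi).symm⟩
        · refine ⟨p + d, le_rfl, le_antisymm (fun x hx => ?_) (flagOf_le fun k _ => ?_)⟩
          · have h4 := congrArg Subtype.val (b.sum_repr ⟨x, hx⟩)
            simp only [Submodule.coe_sum, Submodule.coe_smul] at h4
            rw [← h4]
            refine Submodule.sum_mem _ fun i _ => Submodule.smul_mem _ _ ?_
            have h5 : e' (p + i) = b i := by simp [e']
            rw [← h5]
            exact mem_flagOf e' (by have := i.2; omega)
          · rcases heF k with h | ⟨l, hl, -, h⟩
            · rw [h]; exact Submodule.zero_mem _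
            · exact hF (by omega) h
    · refine ⟨e, p, h1, fun k => (h2 k).imp_right fun ⟨j, hj, h⟩ => ⟨j, by omega, h⟩,
        fun j hj hjt => ?_⟩
      rcases Nat.lt_succ_iff_lt_or_eq.1 hj with hj | rfl
      · exact h3 j hj hjt
      · exact absurd hjt hn

namespace ClassicalDatum

variable {V : Type*} [AddCommGroup V] [Module ℂ V]

/-! ### Large implies finitely many double cosets, in type (A). -/

section Sufficiency

variable {D : ClassicalDatum V} {E : Basis ℕ ℂ V} {P : Subgroup D.G}

/-- The action of `G` on the dual space. -/
def dualRep (D : ClassicalDatum V) : D.G →* (Dual ℂ V ≃ₗ[ℂ] Dual ℂ V) where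
  toFun g := (g : V ≃ₗ[ℂ] V).symm.dualMap
  map_one' := rfl
  map_mul' _ _ := rfl

theorem dualRep_apply (g : D.G) (y : Dual ℂ V) (v : V) :
    D.dualRep g y ((g : V ≃ₗ[ℂ] V) v) = y v := by
  change y ((g : V ≃ₗ[ℂ] V).symm ((g : V ≃ₗ[ℂ] V) v)) = y v
  rw [LinearEquiv.symm_apply_apply]

theorem not_finiteDimensional_of_basis (E : Basis ℕ ℂ V) : ¬ FiniteDimensional ℂ V := fun _ =>
  not_finite_iff_infinite.2 inferInstance (Module.Finite.finite_basis E)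

theorem coord_mem_vstar (hE : D.IsAdmissible E) (a : ℕ) : E.coord a ∈ D.Vstar := by
  rw [hE.vstar_eq]
  exact Submodule.subset_span ⟨a, rfl⟩

theorem exists_transvection (hE : D.IsAdmissible E) (hf : D.form = none) {x : Dual ℂ V}
    (hx : x ∈ D.Vstar) {u : V} (hxu : x u = 0) :
    ∃ g : D.G, (∀ z, D.G.subtype g z = z + x z • u) ∧ ∀ y, D.dualRep g y = y - y u • x := by
  rw [hE.vstar_eq] at hx
  obtain ⟨S, hS⟩ := finite_support_of_mem_span_coord hx
  have happ : ∀ z, LinearEquiv.transvection hxu z = z + x z • u := fun z => rfl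
  refine ⟨⟨LinearEquiv.transvection hxu, mem_G_of_finite_support hE S _ (fun a ha => ?_)
    (fun ω hω => by simp [hf] at hω)⟩, happ, fun y => ?_⟩
  · rw [happ, hS a ha, zero_smul, add_zero]
  · ext z
    change y ((LinearEquiv.transvection hxu).symm z) = y z - y u * x z
    have : (LinearEquiv.transvection hxu).symm z = z - x z • u := by
      rw [LinearEquiv.symm_apply_eq, happ, map_sub, map_smul, hxu]
      simp
    rw [this, map_sub, map_smul, smul_eq_mul, mul_comm]

theorem exists_vstar_separating (hE : D.IsAdmissible E) (v : V) (hv : v ≠ 0) :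
    ∃ y ∈ D.Vstar, y v ≠ 0 := by
  by_contra! h
  exact hv (E.ext_elem fun a => by simpa using h _ (coord_mem_vstar hE a))

/-- In type (A), two elements of `G` with equal relative positions are in the same double coset
of the stabilizer of a pair of flags. -/
theorem exists_double_coset_of_relPos_eq (hE : D.IsAdmissible E) (hf : D.form = none)
    {e : ℕ → V} {φ : ℕ → Dual ℂ V} {p q : ℕ} (hp : ∀ k ≥ p, e k = 0) (hq : ∀ k ≥ q, φ k = 0)
    (hφ : ∀ k, φ k ∈ D.Vstar) (hφe : ∀ j i, φ j (e i) = 0) {g h : D.G}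
    (h1 : ∀ k < p, relPos LinearMap.id e φ p q
        ((flagOf ℂ e k).map (D.G.subtype g : V →ₗ[ℂ] V)) (D.G.subtype g (e k)) =
      relPos LinearMap.id e φ p q
        ((flagOf ℂ e k).map (D.G.subtype h : V →ₗ[ℂ] V)) (D.G.subtype h (e k)))
    (h2 : ∀ k < q, relPos (Dual.eval ℂ V) φ e q p
        ((flagOf ℂ φ k).map (D.dualRep g : Dual ℂ V →ₗ[ℂ] Dual ℂ V)) (D.dualRep g (φ k)) =
      relPos (Dual.eval ℂ V) φ e q p
        ((flagOf ℂ φ k).map (D.dualRep h : Dual ℂ V →ₗ[ℂ] Dual ℂ V)) (D.dualRep h (φ k))) :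
    ∃ b ∈ flagStab D.G.subtype e ⊓ flagStab D.dualRep φ,
      ∃ b' ∈ flagStab D.G.subtype e ⊓ flagStab D.dualRep φ, h = b * g * b' := by
  have hp' := flagOf_le_of_eventually_zero (K := ℂ) hp
  have hq' := flagOf_le_of_eventually_zero (K := ℂ) hq
  have horth : ∀ y ∈ flagOf ℂ φ q, ∀ z ∈ flagOf ℂ e p, y z = 0 := by
    intro y hy z hz
    have h3 : flagOf ℂ e p ≤ LinearMap.ker y := by
      refine flagOf_le fun i _ => ?_
      have h4 : flagOf ℂ φ q ≤ LinearMap.ker (Dual.eval ℂ V (e i)) :=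
        flagOf_le fun j _ => hφe j i
      exact h4 hy
    exact h3 hz
  have hmapV : ∀ (x : D.G) (k : ℕ), (flagOf ℂ φ k).map
      (D.dualRep x : Dual ℂ V →ₗ[ℂ] Dual ℂ V) ≤ D.Vstar := by
    intro x k
    have h3 : flagOf ℂ φ k ≤ D.Vstar := flagOf_le fun j _ => hφ j
    exact (Submodule.map_mono h3).trans x.2.1.1.le
  have hmapV' : ∀ (x : D.G) (k : ℕ), D.dualRep x (φ k) ∈ D.Vstar := fun x k =>
    x.2.1.1.le ⟨φ k, hφ k, rfl⟩
  obtain ⟨b, hb, hbk⟩ := exists_mul_map_flag_eq D.G.subtype e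
    (flagStab D.G.subtype e ⊓ flagStab D.dualRep φ) (relPos LinearMap.id e φ p q)
    (fun b hb F v => relPos_map (fun g y x => dualRep_apply g y x) hb.1 hb.2 F v) g h p
    (fun b hb k hk hbg hcode => by
      obtain ⟨b', hb', hfix, -, hres⟩ := exists_step_of_transvections (Γ := D.G)
        (ρ := D.G.subtype) (τ := D.dualRep) (B := LinearMap.id) (AX := ⊤) (AY := D.Vstar)
        (Ψ := ⊥) (fun x hx u _ hxu => exists_transvection hE hf hx hxu)
        (exists_vstar_separating hE) hφ hp' hq' horth le_top trivial trivial
        (fun y hy => by rw [(Submodule.mem_bot ℂ).1 hy]; simp)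
        (fun y hy => by rw [(Submodule.mem_bot ℂ).1 hy]; simp)
        (fun y hy => by rw [(Submodule.mem_bot ℂ).1 hy]; simp) hcode
      exact ⟨b', hb', hfix, hres⟩) h1
  have hbk' : ∀ k, (flagOf ℂ e k).map (D.G.subtype (b * g) : V →ₗ[ℂ] V) =
      (flagOf ℂ e k).map (D.G.subtype h : V →ₗ[ℂ] V) := fun k => by
    rcases le_total k p with hk | hk
    · exact hbk k hk
    · rw [le_antisymm (hp' k) (flagOf_mono e hk)]
      exact hbk p le_rfl
  -- Second stage, with `V` and its dual exchanged. The acting group is cut down to the elements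
  -- that also preserve the flag `h⟨e⟩` reached in the first stage; taking that flag as `Ψ` keeps
  -- the steps inside this group.
  obtain ⟨b₂, hb₂, hbk₂⟩ := exists_mul_map_flag_eq D.dualRep φ
    ((flagStab D.dualRep φ ⊓ flagStab D.G.subtype e) ⊓
      flagStab D.G.subtype fun k => D.G.subtype h (e k)) (relPos (Dual.eval ℂ V) φ e q p)
    (fun b hb F v => relPos_map (fun g y x => dualRep_apply g x y) hb.1.1 hb.1.2 F v)
    (b * g) h q
    (fun b' hb' k hk hbg hcode => by
      have hflag : (flagOf ℂ e p).map (D.G.subtype (b' * (b * g)) : V →ₗ[ℂ] V) =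
          (flagOf ℂ e p).map (D.G.subtype h : V →ₗ[ℂ] V) := by
        rw [map_rep_mul, hbk']
        have := hb'.2 p
        rwa [← flagOf_map (D.G.subtype h)] at this
      have horth' : ∀ (x : D.G) (k : ℕ), ∀ y ∈ (flagOf ℂ e p).map
          (D.G.subtype x : V →ₗ[ℂ] V), D.dualRep x (φ k) y = 0 := by
        rintro x k _ ⟨y, hy, rfl⟩
        have h3 : flagOf ℂ e p ≤ LinearMap.ker (φ k) := flagOf_le fun i _ => hφe k i
        exact (dualRep_apply x (φ k) y).trans (h3 hy)
      obtain ⟨b'', hb'', hfix, hfix', hres⟩ := exists_step_of_transvections (Γ := D.G)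
        (ρ := D.dualRep) (τ := D.G.subtype) (B := Dual.eval ℂ V) (AX := D.Vstar) (AY := ⊤)
        (Ψ := (flagOf ℂ e p).map (D.G.subtype h : V →ₗ[ℂ] V))
        (fun x _ u hu hxu => by
          -- A transvection acts on `V` and on the dual with opposite signs, hence the sign when the
          -- two roles are exchanged.
          obtain ⟨g, hg, hg'⟩ := exists_transvection hE hf hu (u := -x) (by
            rw [map_neg, neg_eq_zero]; exact hxu)
          refine ⟨g, fun z => ?_, fun y => ?_⟩
          · rw [hg', map_neg, neg_smul, sub_neg_eq_add]
            rfl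
          · rw [hg, smul_neg, ← sub_eq_add_neg]
            rfl)
        (fun v hv => by
          by_contra! hcon
          exact hv (LinearMap.ext fun x => hcon x trivial))
        (fun _ => trivial) hq' hp' (fun y hy z hz => horth z hz y hy)
        (hmapV h k) (hmapV' (b' * (b * g)) k) (hmapV' h k)
        (fun y hy f hf => by
          have h4 : (flagOf ℂ φ k).map (D.dualRep h : Dual ℂ V →ₗ[ℂ] Dual ℂ V) ≤
              LinearMap.ker (Dual.eval ℂ V y) := by
            rw [flagOf_map]
            exact flagOf_le fun i _ => horth' h i y hy
          exact h4 hf)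
        (fun y hy => horth' _ k y (by rw [hflag]; exact hy)) (fun y hy => horth' h k y hy) hcode
      refine ⟨b'', ⟨hb'', fun j => ?_⟩, hfix, hres⟩
      rw [← flagOf_map (D.G.subtype h)]
      exact map_eq_of_forall_fixed fun f hf => hfix' f (Submodule.map_mono (hp' j) hf))
    (fun k hk => by
      rw [← h2 k hk, map_rep_mul, map_mul]
      exact relPos_map (fun g y x => dualRep_apply g x y) hb.2 hb.1 _ _)
  have hbk₂' : ∀ k, (flagOf ℂ φ k).map
      (D.dualRep (b₂ * (b * g)) : Dual ℂ V →ₗ[ℂ] Dual ℂ V) =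
      (flagOf ℂ φ k).map (D.dualRep h : Dual ℂ V →ₗ[ℂ] Dual ℂ V) := fun k => by
    rcases le_total k q with hk | hk
    · exact hbk₂ k hk
    · rw [le_antisymm (hq' k) (flagOf_mono φ hk)]
      exact hbk₂ q le_rfl
  refine ⟨b₂ * b, mul_mem ⟨hb₂.1.2, hb₂.1.1⟩ hb, (b₂ * b * g)⁻¹ * h, ⟨fun k => ?_, fun k => ?_⟩,
    by group⟩
  · rw [map_rep_mul]
    have : (flagOf ℂ e k).map (D.G.subtype (b₂ * b * g) : V →ₗ[ℂ] V) =
        (flagOf ℂ e k).map (D.G.subtype h : V →ₗ[ℂ] V) := by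
      rw [mul_assoc, map_rep_mul, hbk' k]
      have := hb₂.2 k
      rwa [← flagOf_map (D.G.subtype h)] at this
    rw [← this, ← map_rep_mul, inv_mul_cancel, map_rep_one]
  · rw [map_rep_mul, ← hbk₂' k, ← map_rep_mul, ← mul_assoc b₂, inv_mul_cancel, map_rep_one]

theorem IsLarge.finite_of_form_eq_none (hf : D.form = none) (hE : D.IsAdmissible E)
    (hH : ∀ g : D.G, (∀ a, ∃ c : ℂ, (g : V ≃ₗ[ℂ] V) (E a) = c • E a) → g ∈ P)
    (hP : D.IsLarge P) : Finite (MulAction.orbitRel.Quotient P (D.G ⧸ P)) := by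
  obtain ⟨-, m, F, hmono, -, -, -, hstab, hfin⟩ := hP
  have hinf := not_finiteDimensional_of_basis E
  -- Truncation at `m` turns the finite flag into a monotone family indexed by `ℕ`.
  let idx : ℕ → Fin (m + 1) := fun k => ⟨min k m, by omega⟩
  have hidx : ∀ k : Fin (m + 1), idx k = k := fun k => Fin.ext (by
    have := k.2
    simp only [idx]
    omega)
  have hidx_mono : Monotone idx := fun a b h => by
    simp only [idx, Fin.mk_le_mk]
    omega
  obtain ⟨e, p, hp, heF, hFe⟩ := exists_flagOf_refinement (fun k => F (idx k))
    (hmono.monotone.comp hidx_mono) {k | FiniteDimensional ℂ (F (idx k))} (fun _ h => h) (m + 1)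
  obtain ⟨φ, q, hq, hφF, hFφ⟩ := exists_flagOf_refinement
    (fun k => (F (idx k).rev).dualAnnihilator ⊓ D.Vstar)
    (fun a b h => inf_le_inf_right _ (Submodule.dualAnnihilator_anti
      (hmono.monotone (Fin.rev_le_rev.2 (hidx_mono h)))))
    {k | FiniteDimensional ℂ (V ⧸ F (idx k).rev)} (fun k hk => by
      have : FiniteDimensional ℂ (V ⧸ F (idx k).rev) := hk
      have : FiniteDimensional ℂ (F (idx k).rev).dualAnnihilator :=
        Module.Finite.equiv (F (idx k).rev).dualQuotEquivDualAnnihilator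
      exact Submodule.finiteDimensional_of_le inf_le_left) (m + 1)
  have hφV : ∀ k, φ k ∈ D.Vstar := fun k => by
    rcases hφF k with h | ⟨j, -, -, h⟩
    · rw [h]; exact Submodule.zero_mem _
    · exact h.2
  have hφe : ∀ j i, φ j (e i) = 0 := fun j i => by
    rcases hφF j with h | ⟨l, -, hl, h⟩
    · rw [h, LinearMap.zero_apply]
    · rcases heF i with h' | ⟨k, -, hk, h'⟩
      · rw [h', map_zero]
      -- In an infinite-dimensional space, a finite-dimensional member of a chain cannot contain a
      -- finite-codimensional one.
      · have hle : F (idx k) ≤ F (idx l).rev := by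
          by_contra hcon
          have hlt : F (idx l).rev ≤ F (idx k) := by
            rcases le_total (idx k) (idx l).rev with h | h
            · exact absurd (hmono.monotone h) hcon
            · exact hmono.monotone h
          have hk' : FiniteDimensional ℂ (F (idx k)) := hk
          have hl' : FiniteDimensional ℂ (V ⧸ F (idx l).rev) := hl
          have := Submodule.finiteDimensional_of_le hlt
          exact hinf (Module.Finite.of_submodule_quotient (F (idx l).rev))
        exact (Submodule.mem_dualAnnihilator _).1 h.1 _ (hle h')
  have hBP : flagStab D.G.subtype e ⊓ flagStab D.dualRep φ ≤ P := by
    intro g hg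
    refine (hstab g).2 fun k => ?_
    rcases hfin k with hk | hk
    · obtain ⟨i, hi⟩ := hFe k k.2 (by
        change FiniteDimensional ℂ (F (idx k))
        rwa [hidx])
      rw [hidx] at hi
      rw [hi]
      exact hg.1 i
    · obtain ⟨i, hi⟩ := hFφ k.rev k.rev.2 (by
        change FiniteDimensional ℂ (V ⧸ F (idx k.rev).rev)
        rwa [hidx, Fin.rev_rev])
      rw [hidx, Fin.rev_rev] at hi
      -- A finite-codimensional member is cut out by its annihilator within `V_*`: it is spanned by
      -- basis vectors, and the coordinates of the missing ones lie in `V_*` and vanish on it.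
      have hmem : ∀ v, v ∈ F k ↔ ∀ y ∈ flagOf ℂ φ i, y v = 0 := fun v => by
        rw [← hi]
        constructor
        · rintro hv y ⟨hy, -⟩
          exact (Submodule.mem_dualAnnihilator _).1 hy v hv
        · intro hv
          have hsat := fun (v : V) (hv : v ∈ F k) (a : ℕ) (ha : E.repr v a ≠ 0) =>
            basis_mem_of_invariant hE hH (fun g hg => (hstab g).1 hg k) hv ha
          rw [← E.linearCombination_repr v, Finsupp.linearCombination_apply, Finsupp.sum]
          refine Submodule.sum_mem _ fun a ha => Submodule.smul_mem _ _ ?_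
          by_contra hne
          refine Finsupp.mem_support_iff.1 ha (hv (E.coord a) ⟨?_, coord_mem_vstar hE a⟩)
          refine (Submodule.mem_dualAnnihilator _).2 fun w hw => ?_
          by_contra hwa
          exact hne (hsat w hw a hwa)
      ext x
      constructor
      · rintro ⟨v, hv, rfl⟩
        refine (hmem _).2 fun y hy => ?_
        rw [← hg.2 i] at hy
        obtain ⟨y, hy, rfl⟩ := hy
        exact (dualRep_apply g y v).trans ((hmem v).1 hv y hy)
      · intro hx
        refine ⟨(g : V ≃ₗ[ℂ] V).symm x, (hmem _).2 fun y hy => ?_,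
          (g : V ≃ₗ[ℂ] V).apply_symm_apply x⟩
        exact (hmem x).1 hx (D.dualRep g y) (by rw [← hg.2 i]; exact ⟨y, hy, rfl⟩)
  refine finite_of_separating
    (fun g => ((fun k : Fin p => relPos LinearMap.id e φ p q
        ((flagOf ℂ e k).map (D.G.subtype g : V →ₗ[ℂ] V)) (D.G.subtype g (e k))),
      (fun k : Fin q => relPos (Dual.eval ℂ V) φ e q p
        ((flagOf ℂ φ k).map (D.dualRep g : Dual ℂ V →ₗ[ℂ] Dual ℂ V)) (D.dualRep g (φ k)))))
    fun g h hgh => ?_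
  rw [Prod.mk.injEq] at hgh
  obtain ⟨b, hb, b', hb', h⟩ := exists_double_coset_of_relPos_eq hE hf hp hq hφV hφe
    (fun k hk => congrFun hgh.1 ⟨k, hk⟩) (fun k hk => congrFun hgh.2 ⟨k, hk⟩)
  exact ⟨b, hBP hb, b', hBP hb', h⟩

end Sufficiency

end ClassicalDatum

namespace ClassicalDatum

variable {V : Type*} [AddCommGroup V] [Module ℂ V]

/-! ### Large implies finitely many double cosets, in types (BD) and (C). -/

section Sufficiency

variable {D : ClassicalDatum V} {E : Basis ℕ ℂ V} {P : Subgroup D.G}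
  {ω : LinearMap.BilinForm ℂ V}

/-- The sign `ε` allows the symmetric and alternating cases to be treated together. -/
theorem exists_form_sign (hω : ω ∈ D.form) :
    ∃ ε : ℂ, ε * ε = 1 ∧ (∀ x y, ω x y = ε * ω y x) ∧ (ε = 1 ∨ ∀ x, ω x x = 0) := by
  rcases (form_eq_some_cases hω).2.2 with h | h
  · exact ⟨1, one_mul 1, fun x y => by rw [one_mul, h], Or.inl rfl⟩
  · refine ⟨-1, by norm_num, fun x y => ?_, Or.inr h⟩
    have := h (x + y)
    simp only [map_add, LinearMap.add_apply, h, zero_add, add_zero] at this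
    linear_combination this

theorem form_basis_apply {i : ℕ → ℕ} (hi : IsBasisInvolution ω E i) (a : ℕ) (v : V) :
    ω (E a) v = ω (E a) (E (i a)) * E.repr v (i a) := by
  conv_lhs => rw [form_apply_eq_coord_smul hi]
  simp

theorem exists_form_apply_ne_zero {i : ℕ → ℕ} (hi : IsBasisInvolution ω E i) {v : V}
    (hv : v ≠ 0) : ∃ y ∈ (⊤ : Submodule ℂ V), ω y v ≠ 0 := by
  by_contra! h
  refine hv (E.ext_elem fun a => ?_)
  have h1 := h (E (i a)) trivial
  rw [form_basis_apply hi, hi.1] at h1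
  simpa using (mul_eq_zero.1 h1).resolve_left ((hi.2.2 _ _).2 (hi.1 a).symm)

theorem exists_support_of_finiteDimensional (E : Basis ℕ ℂ V) (W : Submodule ℂ V)
    [FiniteDimensional ℂ W] : ∃ S : Finset ℕ, ∀ w ∈ W, ∀ a ∉ S, E.repr w a = 0 := by
  obtain ⟨s, hs⟩ := Module.Finite.iff_fg.1 (inferInstance : Module.Finite ℂ W)
  refine ⟨s.biUnion fun w => (E.repr w).support, fun w hw a ha => ?_⟩
  rw [← hs] at hw
  induction hw using Submodule.span_induction with
  | mem x hx =>
    by_contra h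
    exact ha (Finset.mem_biUnion.2 ⟨x, hx, Finsupp.mem_support_iff.2 h⟩)
  | zero => simp
  | add x y _ _ hx hy => simp [hx, hy]
  | smul c x _ hx => simp [hx]

/-- A vector may be replaced by an isotropic one without changing its pairing with a given
finite-dimensional subspace. -/
theorem exists_isotropic_pairing_eq (hω : ω ∈ D.form) {i : ℕ → ℕ}
    (hi : IsBasisInvolution ω E i) (W : Submodule ℂ V) [FiniteDimensional ℂ W] (x : V) :
    ∃ x', ω x' x' = 0 ∧ ∀ w ∈ W, ω x' w = ω x w := by
  obtain ⟨ε, hε, hsymm, h | h⟩ := exists_form_sign hω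
  · obtain ⟨S, hS⟩ := exists_support_of_finiteDimensional E (W ⊔ Submodule.span ℂ {x})
    obtain ⟨T, hT⟩ : ∃ T : Finset ℕ, ∀ a ∉ T, i a ≠ a := by
      by_cases hz : ∃ z, i z = z
      · obtain ⟨z, hz⟩ := hz
        exact ⟨{z}, fun a ha h => ha (Finset.mem_singleton.2 (hi.2.1 _ _ h hz))⟩
      · push Not at hz
        exact ⟨∅, fun a _ => hz a⟩
    obtain ⟨a, ha⟩ := Infinite.exists_notMem_finset (S ∪ S.image i ∪ T)
    simp only [Finset.notMem_union] at ha
    obtain ⟨⟨haS, haiS⟩, haT⟩ := ha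
    have hia := hT a haT
    have hiaS : i a ∉ S := fun h => haiS (Finset.mem_image.2 ⟨_, h, hi.1 a⟩)
    -- A vector with `ω y y ≠ 0` in the symmetric case, taken far enough out in the basis to be
    -- orthogonal to `W` and `x`; a suitable multiple of it corrects `ω x x` to zero.
    set y := E a + E (i a) with hy
    have hyW : ∀ w ∈ W ⊔ Submodule.span ℂ {x}, ω y w = 0 := fun w hw => by
      rw [hy, map_add, LinearMap.add_apply, form_basis_apply hi a, form_basis_apply hi (i a), hi.1,
        hS w hw _ haS, hS w hw _ hiaS, mul_zero, mul_zero, add_zero]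
    have hyx : ω y x = 0 :=
      hyW x (Submodule.mem_sup_right (Submodule.mem_span_singleton_self x))
    have hyy : ω y y ≠ 0 := by
      have h1 : ω (E a) (E a) = 0 := by
        by_contra hne
        exact hia ((hi.2.2 _ _).1 hne).symm
      have h2 : ω (E (i a)) (E (i a)) = 0 := by
        by_contra hne
        exact hia (((hi.2.2 _ _).1 hne).trans (hi.1 a))
      have h3 : ω (E a) (E (i a)) ≠ 0 := (hi.2.2 _ _).2 rfl
      have h4 : ω y y = 2 * ω (E a) (E (i a)) := by
        simp only [hy, map_add, LinearMap.add_apply, h1, h2]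
        rw [hsymm (E (i a)), h]
        ring
      rw [h4]
      exact mul_ne_zero two_ne_zero h3
    obtain ⟨t, ht⟩ := IsAlgClosed.exists_eq_mul_self (-(ω x x) / ω y y)
    refine ⟨x + t • y, ?_, fun w hw => ?_⟩
    · simp only [map_add, map_smul, LinearMap.add_apply, LinearMap.smul_apply, smul_eq_mul]
      rw [hsymm x y, hyx]
      have : t * t * ω y y = - ω x x := by rw [← ht, div_mul_cancel₀ _ hyy]
      linear_combination this
    · simp [hyW w (Submodule.mem_sup_left hw)]
  · exact ⟨x, h x, fun _ _ => rfl⟩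

/-- The isometry taking `v` to `v'` determined by an isotropic vector `x` paired to `1` with
both. -/
theorem exists_isometry_of_isotropic (hE : D.IsAdmissible E) (hω : ω ∈ D.form) {ε : ℂ}
    (hε : ε * ε = 1) (hsymm : ∀ x y, ω x y = ε * ω y x) {x v v' : V} (hx : ω x x = 0)
    (hv : ω v v = 0) (hv' : ω v' v' = 0) (hxv : ω x v = 1) (hxv' : ω x v' = 1) :
    ∃ g : D.G, D.G.subtype g v = v' ∧ ∀ z, D.G.subtype g z =
      z + ω x z • ((v' - v) + (ε * ω v' v) • x) - (ε * ω (v' - v) z) • x := by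
  -- An Eichler transformation for `x` and `v' - v`, which is orthogonal to `x`. The coefficient `ε
  -- * ω v' v` is what sends `v` to `v'`; exchanging `v` and `v'` gives the inverse.
  let T : V → V → (V →ₗ[ℂ] V) := fun v v' => LinearMap.id +
    (ω x).smulRight ((v' - v) + (ε * ω v' v) • x) - (ε • ω (v' - v)).smulRight x
  have hT : ∀ v v' z, T v v' z =
      z + ω x z • ((v' - v) + (ε * ω v' v) • x) - (ε * ω (v' - v) z) • x := fun v v' z => by
    simp [T]
  have hvx : ω v x = ε := by rw [hsymm, hxv, mul_one]
  have hvx' : ω v' x = ε := by rw [hsymm, hxv', mul_one]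
  have hcomp : ∀ v v', ω v v = 0 → ω v' v' = 0 → ω x v = 1 → ω x v' = 1 → ω v x = ε →
      ω v' x = ε → ∀ z, T v' v (T v v' z) = z := by
    intro v v' hv hv' hxv hxv' hvx hvx' z
    have h1 : ω x (T v v' z) = ω x z := by
      rw [hT]
      simp only [map_add, map_sub, map_smul, smul_eq_mul, hx, hxv, hxv']
      ring
    have h2 : ω (v - v') (T v v' z) = ω (v - v') z + ω x z * (ω v v' + ω v' v) := by
      rw [hT]
      simp only [map_add, map_sub, map_smul, smul_eq_mul, LinearMap.sub_apply, hv, hv', hvx, hvx']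
      ring
    rw [hT v' v, h1, h2, hT, hsymm v v']
    simp only [map_sub, LinearMap.sub_apply]
    module
  let e : V ≃ₗ[ℂ] V := LinearEquiv.ofLinearMap (T v v') (T v' v)
    (LinearMap.ext (hcomp v' v hv' hv hxv' hxv hvx' hvx))
    (LinearMap.ext (hcomp v v' hv hv' hxv hxv' hvx hvx'))
  have he : ∀ z, e z = z + ω x z • ((v' - v) + (ε * ω v' v) • x) - (ε * ω (v' - v) z) • x :=
    hT v v'
  have hfin : ∀ y, ∃ S : Finset ℕ, ∀ a ∉ S, ω y (E a) = 0 := fun y => by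
    refine finite_support_of_mem_span_coord ?_
    rw [← hE.vstar_eq, (form_eq_some_cases hω).1]
    exact ⟨y, rfl⟩
  obtain ⟨S, hS⟩ := hfin x
  obtain ⟨S', hS'⟩ := hfin (v' - v)
  refine ⟨⟨e, mem_G_of_finite_support hE (S ∪ S') e (fun a ha => ?_) fun ω' hω' z w => ?_⟩,
    ?_, he⟩
  · rw [Finset.notMem_union] at ha
    rw [he, hS a ha.1, hS' a ha.2]
    simp
  · obtain rfl : ω = ω' := by
      rw [Option.mem_def] at hω hω'
      exact Option.some.inj (hω.symm.trans hω')
    rw [he, he]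
    simp only [map_add, map_sub, map_smul, smul_eq_mul, LinearMap.add_apply, LinearMap.sub_apply,
      LinearMap.smul_apply, hx, hxv, hxv', hvx, hvx', hv, hv', hsymm z x, hsymm z v, hsymm z v',
      hsymm v v']
    linear_combination (ω x z * (ω x w * ω v' v - (ω v' w - ω v w))) * hε
  · change e v = v'
    rw [he, hxv, map_sub, LinearMap.sub_apply, hv]
    module

theorem finiteDimensional_orthogonal {i : ℕ → ℕ} (hω : ω ∈ D.form)
    (hi : IsBasisInvolution ω E i) (W : Submodule ℂ V) [FiniteDimensional ℂ (V ⧸ W)] :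
    FiniteDimensional ℂ (ω.orthogonal W) := by
  obtain ⟨ε, -, hsymm, -⟩ := exists_form_sign hω
  have hinj : Function.Injective ω := by
    refine (injective_iff_map_eq_zero ω).2 fun v hv => ?_
    by_contra hne
    obtain ⟨y, -, hy⟩ := exists_form_apply_ne_zero hi hne
    rw [hsymm, hv] at hy
    simp at hy
  have : FiniteDimensional ℂ W.dualAnnihilator :=
    Module.Finite.equiv W.dualQuotEquivDualAnnihilator
  have hle : (ω.orthogonal W).map ω ≤ W.dualAnnihilator := by
    rintro _ ⟨y, hy, rfl⟩
    refine (Submodule.mem_dualAnnihilator _).2 fun w hw => ?_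
    have : ω w y = 0 := hy w hw
    rw [hsymm, this, mul_zero]
  have := Submodule.finiteDimensional_of_le hle
  exact Module.Finite.equiv (Submodule.equivMapOfInjective ω hinj _).symm

theorem finiteDimensional_quotient_orthogonal (W : Submodule ℂ V) [FiniteDimensional ℂ W] :
    FiniteDimensional ℂ (V ⧸ ω.orthogonal W) := by
  let T : V →ₗ[ℂ] Dual ℂ W := W.subtype.dualMap ∘ₗ ω.flip
  have hker : LinearMap.ker T ≤ ω.orthogonal W := fun v hv w hw =>
    LinearMap.congr_fun (LinearMap.mem_ker.1 hv) ⟨w, hw⟩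
  have : FiniteDimensional ℂ (V ⧸ LinearMap.ker T) :=
    Module.Finite.equiv (LinearMap.quotKerEquivRange T).symm
  exact Module.Finite.of_surjective (Submodule.factor hker) (Submodule.factor_surjective hker)

/-- One step of the matching of two isotropic flags. -/
theorem exists_step_of_form (hE : D.IsAdmissible E) (hω : ω ∈ D.form) {e : ℕ → V} {p : ℕ}
    (hp : ∀ k, flagOf ℂ e k ≤ flagOf ℂ e p)
    (hiso : ∀ y ∈ flagOf ℂ e p, ∀ z ∈ flagOf ℂ e p, ω y z = 0) {F : Submodule ℂ V}
    [FiniteDimensional ℂ F] (hF : ∀ f ∈ F, ∀ f' ∈ F, ω f f' = 0) {v v' : V} (hv : ω v v = 0)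
    (hv' : ω v' v' = 0) (hvF : ∀ f ∈ F, ω v f = 0) (hvF' : ∀ f ∈ F, ω v' f = 0)
    (h : relPos ω e e p p F v = relPos ω e e p p F v') :
    ∃ g ∈ flagStab D.G.subtype e, (∀ f ∈ F, D.G.subtype g f = f) ∧
      ∃ c : ℂ, c ≠ 0 ∧ D.G.subtype g v - c • v' ∈ F := by
  obtain ⟨i, hi⟩ := hE.exists_involution hω
  obtain ⟨ε, hε, hsymm, -⟩ := exists_form_sign hω
  have hsep := fun (v : V) (hv : v ≠ 0) => exists_form_apply_ne_zero hi hv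
  obtain ⟨w, w', c, hc, hw, hw', hcase⟩ := exists_normalization_of_relPos_eq h
  have hFv : ∀ f ∈ F, ω f v = 0 := fun f hf => by rw [hsymm, hvF f hf, mul_zero]
  have hFv' : ∀ f ∈ F, ω f v' = 0 := fun f hf => by rw [hsymm, hvF' f hf, mul_zero]
  have hmod : ∀ (t : ℂ) (v w : V), ω v v = 0 → (∀ f ∈ F, ω v f = 0) → w - t • v ∈ F →
      ω w w = 0 ∧ ∀ f ∈ F, ω w f = 0 := by
    intro t v w hv hvF hw
    obtain ⟨f, hf, rfl⟩ : ∃ f ∈ F, w = t • v + f := ⟨_, hw, by abel⟩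
    refine ⟨?_, fun f' hf' => by simp [hvF f' hf', hF f hf f' hf']⟩
    simp [hv, hvF f hf, hF f hf f hf, hsymm f v]
  obtain ⟨hww, hwF⟩ := hmod 1 v w hv hvF (by rwa [one_smul])
  obtain ⟨hww', hwF'⟩ := hmod c v' w' hv' hvF' hw'
  have hfinish : ∀ (g : D.G) (t : ℂ), t ≠ 0 → (∀ f ∈ F, D.G.subtype g f = f) →
      D.G.subtype g w = t • w' → ∃ c : ℂ, c ≠ 0 ∧ D.G.subtype g v - c • v' ∈ F :=
    fun g t ht hgF hgw => by
      refine ⟨t * c, mul_ne_zero ht hc, ?_⟩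
      have h1 : D.G.subtype g v = t • w' - (w - v) := by
        rw [← hgw, ← hgF _ hw, ← map_sub, sub_sub_cancel]
      have h2 : D.G.subtype g v - (t * c) • v' = t • (w' - c • v') - (w - v) := by
        rw [h1, smul_sub, smul_smul]; abel
      rw [h2]
      exact F.sub_mem (F.smul_mem _ hw') hw
  have huF : ∀ t : ℂ, ∀ f ∈ F, ω (t • w' - w) f = 0 := fun t f hf => by
    rw [map_sub, LinearMap.sub_apply, map_smul, LinearMap.smul_apply, hwF f hf, hwF' f hf,
      smul_zero, sub_zero]
  rcases hcase with ⟨rfl, rfl⟩ | ⟨i', hi', hwi, hwi', hu, hwE⟩ | ⟨hwE, hwE', hφ⟩ |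
    ⟨j, hj, x, hx, hxF, hxw, hxw', hu⟩
  · exact ⟨1, one_mem _, fun f _ => rfl, hfinish 1 1 one_ne_zero (fun f _ => rfl) (by simp)⟩
  · obtain ⟨x₀, -, hx₀W, hx₀w⟩ := exists_separating hsep hwE
    -- The separating vector need not be isotropic, so it is replaced by an isotropic one with the
    -- same pairings. As `w` and `w'` lie in the isotropic flag, the correction terms vanish on it
    -- and the map acts there as a transvection.
    obtain ⟨x, hxx, hx⟩ := exists_isotropic_pairing_eq hω hi
      ((flagOf ℂ e i' ⊔ F) ⊔ Submodule.span ℂ {w}) x₀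
    have hxW : ∀ z ∈ flagOf ℂ e i' ⊔ F, ω x z = 0 := fun z hz => by
      rw [hx z (Submodule.mem_sup_left hz), hx₀W z hz]
    have hxw : ω x w = 1 := by
      rw [hx w (Submodule.mem_sup_right (Submodule.mem_span_singleton_self w)), hx₀w]
    have hxw' : ω x w' = 1 := by
      have := hxW _ (Submodule.mem_sup_left hu)
      rw [map_sub, sub_eq_zero] at this
      rw [this, hxw]
    obtain ⟨g, hgw, hg⟩ := exists_isometry_of_isotropic hE hω hε hsymm hxx hww hww' hxw hxw'
    have hw'w : ω w' w = 0 := hiso _ (hp _ hwi') _ (hp _ hwi)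
    have hgF : ∀ f ∈ F, D.G.subtype g f = f := fun f hf => by
      have h1 := huF 1 f hf
      rw [one_smul] at h1
      rw [hg, hxW f (Submodule.mem_sup_right hf), h1]
      simp
    refine ⟨g, mem_flagStab_of_forall_mem fun k z hz => ?_, hgF,
      hfinish g 1 one_ne_zero hgF (by rw [hgw, one_smul])⟩
    rw [hg, hw'w, hiso _ (hp _ hu) z (hp k hz)]
    simp only [mul_zero, zero_smul, add_zero, sub_zero]
    by_cases hk : k ≤ i'
    · rwa [hxW z (Submodule.mem_sup_left (flagOf_mono e hk hz)), zero_smul, add_zero]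
    · exact Submodule.add_mem _ hz (Submodule.smul_mem _ _ (flagOf_mono e (by omega) hu))
  · obtain ⟨x₀, -, hx₀W, hx₀w, hx₀w'⟩ := exists_separating_two hsep hwE hwE'
    have := FiniteDimensional.span_of_finite ℂ (Set.toFinite {w, w'})
    obtain ⟨x, hxx, hx⟩ := exists_isotropic_pairing_eq hω hi
      ((flagOf ℂ e p ⊔ F) ⊔ Submodule.span ℂ {w, w'}) x₀
    have hxW : ∀ z ∈ flagOf ℂ e p ⊔ F, ω x z = 0 := fun z hz => by
      rw [hx z (Submodule.mem_sup_left hz), hx₀W z hz]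
    have hxw : ω x w = 1 := by
      rw [hx w (Submodule.mem_sup_right (Submodule.subset_span (by simp))), hx₀w]
    have hxw' : ω x w' ≠ 0 := by
      rwa [hx w' (Submodule.mem_sup_right (Submodule.subset_span (by simp)))]
    set t := (ω x w')⁻¹ with ht
    obtain ⟨g, hgw, hg⟩ := exists_isometry_of_isotropic hE hω hε hsymm hxx hww
      (v' := t • w') (by simp [hww']) hxw (by simp [ht, hxw'])
    have hgF : ∀ f ∈ F, D.G.subtype g f = f := fun f hf => by
      rw [hg, hxW f (Submodule.mem_sup_right hf), huF t f hf]
      simp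
    refine ⟨g, mem_flagStab_of_forall_mem fun k z hz => ?_, hgF,
      hfinish g t (inv_ne_zero hxw') hgF hgw⟩
    have h1 := hφ z (hp k hz)
    have h2 : ω (t • w' - w) z = 0 := by rw [hsymm]; simp [h1]
    rw [hg, hxW z (Submodule.mem_sup_left (hp k hz)), h2]
    simpa using hz
  -- Here `x` lies in the isotropic flag, so it is isotropic already; the flag moves only along `x`,
  -- and step `j` is fixed pointwise.
  · have hxx : ω x x = 0 := hiso _ (hp _ hx) _ (hp _ hx)
    obtain ⟨g, hgw, hg⟩ := exists_isometry_of_isotropic hE hω hε hsymm hxx hww hww' hxw hxw'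
    have hgF : ∀ f ∈ F, D.G.subtype g f = f := fun f hf => by
      have h1 := huF 1 f hf
      rw [one_smul] at h1
      rw [hg, hxF f hf, h1]
      simp
    refine ⟨g, mem_flagStab_of_forall_mem fun k z hz => ?_, hgF,
      hfinish g 1 one_ne_zero hgF (by rw [hgw, one_smul])⟩
    rw [hg, hiso x (hp _ hx) z (hp k hz), zero_smul, add_zero]
    by_cases hk : k ≤ j
    · rw [hsymm, hu z (flagOf_mono e hk hz), mul_zero, mul_zero, zero_smul, sub_zero]
      exact hz
    · exact Submodule.sub_mem _ hz (Submodule.smul_mem _ _ (flagOf_mono e (by omega) hx))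

theorem IsLarge.finite_of_form_eq_some (hω : ω ∈ D.form) (hE : D.IsAdmissible E)
    (hP : D.IsLarge P) : Finite (MulAction.orbitRel.Quotient P (D.G ⧸ P)) := by
  obtain ⟨-, m, F, hmono, -, -, hperp, hstab, hfin⟩ := hP
  have hinf := not_finiteDimensional_of_basis E
  obtain ⟨i, hi⟩ := hE.exists_involution hω
  obtain ⟨ε, -, hsymm, -⟩ := exists_form_sign hω
  have hG : ∀ (g : D.G) (v w : V), ω (D.G.subtype g v) (D.G.subtype g w) = ω v w :=
    fun g => g.2.2 ω hω
  let idx : ℕ → Fin (m + 1) := fun k => ⟨min k m, by omega⟩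
  have hidx : ∀ k : Fin (m + 1), idx k = k := fun k => Fin.ext (by
    have := k.2
    simp only [idx]
    omega)
  have hidx_mono : Monotone idx := fun a b h => by
    simp only [idx, Fin.mk_le_mk]
    omega
  obtain ⟨e, p, hp, heF, hFe⟩ := exists_flagOf_refinement (fun k => F (idx k))
    (hmono.monotone.comp hidx_mono) {k | FiniteDimensional ℂ (F (idx k))} (fun _ h => h) (m + 1)
  have hFiso : ∀ k, FiniteDimensional ℂ (F k) → ∀ y ∈ F k, ∀ z ∈ F k, ω y z = 0 := by
    intro k hk y hy z hz
    have hle : F k ≤ ω.orthogonal (F k) := by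
      rw [hperp ω hω]
      rcases le_total k k.rev with h | h
      · exact hmono.monotone h
      -- If `k.rev ≤ k`, the finite-codimensional `F k.rev` would lie in the finite-dimensional `F
      -- k`, forcing `V` to be finite dimensional.
      · exfalso
        have h1 : FiniteDimensional ℂ (V ⧸ F k.rev) := by
          rw [← hperp ω hω]
          exact finiteDimensional_quotient_orthogonal _
        have := Submodule.finiteDimensional_of_le (hmono.monotone h)
        exact hinf (Module.Finite.of_submodule_quotient (F k.rev))
    exact hle hz y hy
  have hee : ∀ j k, ω (e j) (e k) = 0 := fun j k => by
    rcases heF j with h | ⟨a, -, ha, h⟩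
    · rw [h, map_zero, LinearMap.zero_apply]
    · rcases heF k with h' | ⟨b, -, hb, h'⟩
      · rw [h', map_zero]
      · rcases le_total (idx a) (idx b) with hab | hab
        · exact hFiso _ hb _ (hmono.monotone hab h) _ h'
        · exact hFiso _ ha _ h _ (hmono.monotone hab h')
  have hp' := flagOf_le_of_eventually_zero (K := ℂ) hp
  have hflag : ∀ j k, ∀ y ∈ flagOf ℂ e j, ∀ z ∈ flagOf ℂ e k, ω y z = 0 := by
    intro j k y hy z hz
    have h3 : flagOf ℂ e k ≤ LinearMap.ker (ω y) := by
      refine flagOf_le fun l _ => ?_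
      have h4 : flagOf ℂ e j ≤ LinearMap.ker (ω.flip (e l)) := flagOf_le fun n _ => hee n l
      exact h4 hy
    exact h3 hz
  have hBP : flagStab D.G.subtype e ≤ P := by
    intro g hg
    have hfd : ∀ k, FiniteDimensional ℂ (F k) →
        (F k).map (D.G.subtype g : V →ₗ[ℂ] V) = F k := fun k hk => by
      obtain ⟨i, hi⟩ := hFe k k.2 (by
        change FiniteDimensional ℂ (F (idx k))
        rwa [hidx])
      rw [hidx] at hi
      rw [hi]
      exact hg i
    refine (hstab g).2 fun k => ?_
    rcases hfin k with hk | hk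
    · exact hfd k hk
    -- A finite-codimensional member is the orthogonal of the finite-dimensional `F k.rev`, so an
    -- isometry preserving the latter preserves it.
    · have h1 : FiniteDimensional ℂ (F k.rev) := by
        rw [← hperp ω hω]
        exact finiteDimensional_orthogonal hω hi _
      have h2 := hfd _ h1
      have h3 := hperp ω hω k.rev
      rw [Fin.rev_rev] at h3
      rw [← h3]
      ext x
      constructor
      · rintro ⟨v, hv, rfl⟩ w hw
        rw [← h2] at hw
        obtain ⟨w, hw, rfl⟩ := hw
        exact (hG g w v).trans (hv w hw)
      · intro hx
        refine ⟨(g : V ≃ₗ[ℂ] V).symm x, fun w hw => ?_, (g : V ≃ₗ[ℂ] V).apply_symm_apply x⟩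
        refine (hG g w _).symm.trans ?_
        change ω _ ((g : V ≃ₗ[ℂ] V) ((g : V ≃ₗ[ℂ] V).symm x)) = 0
        rw [LinearEquiv.apply_symm_apply]
        exact hx _ (by rw [← h2]; exact ⟨w, hw, rfl⟩)
  refine finite_of_separating (fun g => fun k : Fin p => relPos ω e e p p
    ((flagOf ℂ e k).map (D.G.subtype g : V →ₗ[ℂ] V)) (D.G.subtype g (e k))) fun g h hgh => ?_
  have hpair : ∀ (x : D.G) (k : ℕ), ∀ f ∈ (flagOf ℂ e k).map (D.G.subtype x : V →ₗ[ℂ] V),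
      ω (D.G.subtype x (e k)) f = 0 := by
    rintro x k _ ⟨f, hf, rfl⟩
    exact (hG x _ _).trans (hflag (k + 1) k _ (mem_flagOf e (Nat.lt_succ_self k)) f hf)
  obtain ⟨b, hb, hbk⟩ := exists_mul_map_flag_eq D.G.subtype e (flagStab D.G.subtype e)
    (relPos ω e e p p) (fun b hb F v => relPos_map hG hb hb F v) g h p
    (fun b hb k hk hbg hcode => exists_step_of_form hE hω hp' (hflag p p)
      (by
        rintro _ ⟨f, hf, rfl⟩ _ ⟨f', hf', rfl⟩
        exact (hG h f f').trans (hflag k k f hf f' hf'))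
      ((hG _ _ _).trans (hee k k)) ((hG _ _ _).trans (hee k k))
      (by rw [← hbg]; exact hpair _ k) (hpair h k) hcode)
    fun k hk => congrFun hgh ⟨k, hk⟩
  refine ⟨b, hBP hb, (b * g)⁻¹ * h, hBP fun k => ?_, by group⟩
  have hbk' : (flagOf ℂ e k).map (D.G.subtype (b * g) : V →ₗ[ℂ] V) =
      (flagOf ℂ e k).map (D.G.subtype h : V →ₗ[ℂ] V) := by
    rcases le_total k p with hk | hk
    · exact hbk k hk
    · rw [le_antisymm (hp' k) (flagOf_mono e hk)]
      exact hbk p le_rfl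
  rw [map_rep_mul, ← hbk', ← map_rep_mul, inv_mul_cancel, map_rep_one]

end Sufficiency

end ClassicalDatum
theorem mainTheorem4 {V : Type*} [AddCommGroup V] [Module ℂ V]
    (hV : Module.rank ℂ V = Cardinal.aleph0) (D : ClassicalDatum V)
    (P : Subgroup D.G) (hP : D.IsSplittingParabolic P) :
    Finite (MulAction.orbitRel.Quotient P (D.G ⧸ P)) ↔ D.IsLarge P := by
  refine ⟨fun _ => hP.isLarge_of_finite, fun h => ?_⟩
  obtain ⟨E, hE, hH, -⟩ := hP
  rcases hf : D.form with _ | ω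
  · exact h.finite_of_form_eq_none hf hE hH
  · exact h.finite_of_form_eq_some hf hE
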